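/- Let $k$ be any field. For a finite simple graph $G$ with vertex set $V$ let $R=k[V]$ be the polynomial ring whose variables are the vertices of $G$, and let $I(G)\subseteq R$ be the ideal generated by the products $xy$ over all edges $\{x,y\}$ of $G$. Give $R/I(G)$ and $\mathrm{Tor}^R_i(R/I(G),k)$, where $k=R/(x : x\in V)$, their natural $\mathbb{N}^V$-gradings. For $i,d\in\mathbb{N}$ put $$\beta_{i,d}(G)=\sum_{a\in\mathbb{N}^V,\ |a|=d}\dim_k \mathrm{Tor}^R_i(R/I(G),k)_a ,$$ where $|a|$ is the sum of the entries of $a$, and let $\beta_{i,d}(G)=0$ if $i<0$ or $d<0$. **Theorem.** Let $T$ be a finite forest and let $v$ be a vertex of $T$ with $n\ge 1$ distinct neighbours $v_1,\dots,v_n$, such that $v_1,\dots,v_{n-1}$ have degree $1$ in $T$ (and, if $n=1$, the unique neighbour $v_1$ has degree $1$). Let $T'=T\setminus\{v_1\}$ and $T''=T\setminus\{v,v_1,\dots,v_n\}$ be the graphs obtained from $T$ by deleting these vertices together with all edges that contain them. Then for all integers $i$ and $d$ $$\beta_{i,d}(T)=\beta_{i,d}(T')+\sum_{j=0}^{n-1}\binom{n-1}{j}\,\beta_{i-(j+1),\,d-(j+2)}(T'').$$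 -/

import Mathlib

namespace GraphBetti

open MvPolynomial

/-- The graph ideal `I(G)` of the polynomial ring `k[V]`: it is generated by the monomials
`x y`, one for each edge `{x, y}` of `G`. -/
noncomputable def graphIdeal (k : Type*) [Field k] {V : Type*} (G : SimpleGraph V) :
    Ideal (MvPolynomial V k) :=
  Ideal.span {f | ∃ x y : V, G.Adj x y ∧ f = X x * X y}

/-- A graded free resolution, by free modules of finite rank,
`⋯ → F₂ → F₁ → F₀ → k[V]/I → 0`
of the `ℕ^V`-graded module `k[V]/I` over the `ℕ^V`-graded ring `k[V]`.
Here `Fᵢ` is the free module with basis `Fin (rank i)`, the basis element `p` having degree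
`deg i p`, and the differential `F_{i+1} → F_i` is multiplication by the matrix `d i`. -/
structure GradedFreeResolution {k : Type*} [Field k] {V : Type*}
    (I : Ideal (MvPolynomial V k)) where
  /-- the rank of `Fᵢ` -/
  rank : ℕ → ℕ
  /-- the degrees of the basis elements of `Fᵢ` -/
  deg : (i : ℕ) → Fin (rank i) → (V →₀ ℕ)
  /-- the matrix of the differential `F_{i+1} → F_i` -/
  d : (i : ℕ) → Matrix (Fin (rank i)) (Fin (rank (i + 1))) (MvPolynomial V k)
  /-- the augmentation `F₀ → k[V]/I` -/
  aug : (Fin (rank 0) → MvPolynomial V k) →ₗ[MvPolynomial V k] MvPolynomial V k ⧸ I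
  /-- the differentials are homogeneous of degree `0` -/
  homogeneous_d : ∀ i p q, ∀ m ∈ (d i p q).support, deg i p + m = deg (i + 1) q
  /-- the augmentation is homogeneous of degree `0` -/
  homogeneous_aug : ∀ p, ∃ c : k,
    aug (Pi.single p 1) = Ideal.Quotient.mk I (monomial (deg 0 p) c)
  aug_surjective : Function.Surjective aug
  exact_zero : Function.Exact (d 0).mulVecLin aug
  exact_succ : ∀ i, Function.Exact (d (i + 1)).mulVecLin (d i).mulVecLin

namespace GradedFreeResolution

variable {k : Type*} [Field k] {V : Type*} {I : Ideal (MvPolynomial V k)}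
  (F : GradedFreeResolution I)

/-- The differential `(F_{i+1} ⊗ k)_a → (F_i ⊗ k)_a` in degree `a`, where `k = k[V]/(x : x ∈ V)`:
the module `(F_i ⊗ k)_a` has as its basis the basis elements of `F_i` of degree `a`, and the
entries of the matrix are reduced modulo the variables. -/
noncomputable def strand (i : ℕ) (a : V →₀ ℕ) :
    Matrix {p : Fin (F.rank i) // F.deg i p = a}
      {q : Fin (F.rank (i + 1)) // F.deg (i + 1) q = a} k :=
  Matrix.of fun p q => constantCoeff (F.d i p.1 q.1)

open scoped Classical in
/-- The degree `a` part of the `i`-cycles of `F ⊗ k`. -/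
noncomputable def torCycles (a : V →₀ ℕ) :
    (i : ℕ) → Submodule k ({p : Fin (F.rank i) // F.deg i p = a} → k)
  | 0 => ⊤
  | i + 1 => LinearMap.ker (F.strand i a).mulVecLin

open scoped Classical in
/-- The degree `a` part of the `i`-boundaries of `F ⊗ k`. -/
noncomputable def torBoundaries (a : V →₀ ℕ) (i : ℕ) :
    Submodule k ({p : Fin (F.rank i) // F.deg i p = a} → k) :=
  LinearMap.range (F.strand i a).mulVecLin

/-- `Tor_i(k[V]/I, k)_a`, the degree `a` part of the `i`-th homology of `F ⊗ k`. -/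
abbrev Tor (i : ℕ) (a : V →₀ ℕ) : Type _ :=
  F.torCycles a i ⧸ (F.torBoundaries a i).submoduleOf (F.torCycles a i)

end GradedFreeResolution

section Existence

variable {k : Type*} [Field k] {V : Type*}

open scoped Classical in
/-- The component in degree `a` of an element `g` of the shifted ring `k[V](-δ)`. -/
noncomputable def shiftComp (δ a : V →₀ ℕ) (g : MvPolynomial V k) : MvPolynomial V k :=
  if δ ≤ a then monomial (a - δ) (coeff (a - δ) g) else 0

/-- The component in degree `a` of an element of a graded free module. -/
noncomputable def freeComp {r : ℕ} (deg : Fin r → V →₀ ℕ) (a : V →₀ ℕ)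
    (f : Fin r → MvPolynomial V k) : Fin r → MvPolynomial V k :=
  fun p => shiftComp (deg p) a (f p)

theorem shiftComp_add (δ a : V →₀ ℕ) (g h : MvPolynomial V k) :
    shiftComp δ a (g + h) = shiftComp δ a g + shiftComp δ a h := by
  unfold shiftComp
  split_ifs <;> simp

theorem shiftComp_zero (δ a : V →₀ ℕ) : shiftComp δ a (0 : MvPolynomial V k) = 0 := by
  unfold shiftComp
  split_ifs <;> simp

theorem shiftComp_sum {ι : Type*} (s : Finset ι) (δ a : V →₀ ℕ) (g : ι → MvPolynomial V k) :
    shiftComp δ a (∑ j ∈ s, g j) = ∑ j ∈ s, shiftComp δ a (g j) := by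
  classical
  induction s using Finset.induction_on with
  | empty => simp [shiftComp_zero]
  | insert j s hj ih => rw [Finset.sum_insert hj, Finset.sum_insert hj, shiftComp_add, ih]

theorem shiftComp_monomial_mul (δ t a : V →₀ ℕ) (c : k) (g : MvPolynomial V k) :
    shiftComp δ a (monomial t c * g) = monomial t c * shiftComp (δ + t) a g := by
  unfold shiftComp
  by_cases h : δ + t ≤ a
  · have h1 : δ ≤ a := le_trans le_self_add h
    have h2 : t ≤ a - δ := le_tsub_of_add_le_left h
    rw [if_pos h, if_pos h1, coeff_monomial_mul', if_pos h2, monomial_mul]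
    congr 1
    · rw [← tsub_tsub, add_tsub_cancel_of_le h2]
    · rw [tsub_tsub]
  · rw [if_neg h, mul_zero]
    split_ifs with h1
    · have h2 : ¬ t ≤ a - δ := fun h2 => h ((le_tsub_iff_left h1).1 h2)
      rw [coeff_monomial_mul', if_neg h2, monomial_zero]
    · rfl

theorem shiftComp_mul (δ e a : V →₀ ℕ) (u g : MvPolynomial V k)
    (hu : ∀ m ∈ u.support, δ + m = e) :
    shiftComp δ a (u * g) = u * shiftComp e a g := by
  have key : u * g = ∑ m ∈ u.support, monomial m (coeff m u) * g := by
    conv_lhs => rw [u.as_sum, Finset.sum_mul]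
  rw [key, shiftComp_sum]
  conv_rhs => rw [u.as_sum, Finset.sum_mul]
  refine Finset.sum_congr rfl fun m hm => ?_
  rw [shiftComp_monomial_mul, hu m hm]

theorem shiftComp_support (δ a : V →₀ ℕ) (g : MvPolynomial V k) :
    ∀ m ∈ (shiftComp δ a g).support, δ + m = a := by
  classical
  intro m hm
  unfold shiftComp at hm
  split_ifs at hm with h
  · have := Finset.mem_singleton.1 (support_monomial_subset hm)
    rw [this, add_tsub_cancel_of_le h]
  · simp at hm

theorem sum_shiftComp (δ : V →₀ ℕ) (g : MvPolynomial V k) (S : Finset (V →₀ ℕ))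
    (hS : ∀ m ∈ g.support, δ + m ∈ S) : ∑ a ∈ S, shiftComp δ a g = g := by
  classical
  ext m
  rw [coeff_sum]
  by_cases hm : m ∈ g.support
  · rw [Finset.sum_eq_single_of_mem (δ + m) (hS m hm)]
    · simp [shiftComp]
    · intro a _ ha
      by_contra h
      exact ha (shiftComp_support δ a g m (mem_support_iff.2 h)).symm
  · rw [notMem_support_iff.1 hm]
    refine Finset.sum_eq_zero fun a _ => ?_
    unfold shiftComp
    split_ifs with h
    · rw [coeff_monomial]
      split_ifs with h2
      · rw [h2, notMem_support_iff.1 hm]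
      · rfl
    · simp

/-- A graded free module of finite rank together with a graded submodule. -/
structure Stage (k : Type*) [Field k] (V : Type*) where
  rank : ℕ
  deg : Fin rank → V →₀ ℕ
  sub : Submodule (MvPolynomial V k) (Fin rank → MvPolynomial V k)
  graded : ∀ f ∈ sub, ∀ a, freeComp deg a f ∈ sub

theorem Stage.exists_generators [Finite V] (S : Stage k V) :
    ∃ (s : ℕ) (e : Fin s → V →₀ ℕ) (D : Matrix (Fin S.rank) (Fin s) (MvPolynomial V k)),
      (∀ p q, ∀ m ∈ (D p q).support, S.deg p + m = e q) ∧
        LinearMap.range D.mulVecLin = S.sub := by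
  classical
  obtain ⟨G, hG⟩ : S.sub.FG := IsNoetherian.noetherian S.sub
  let A : (Fin S.rank → MvPolynomial V k) → Finset (V →₀ ℕ) := fun f =>
    Finset.univ.biUnion fun p => (f p).support.image fun m => S.deg p + m
  let H : Finset ((V →₀ ℕ) × (Fin S.rank → MvPolynomial V k)) :=
    G.biUnion fun f => (A f).image fun a => (a, freeComp S.deg a f)
  have hH : ∀ x ∈ H, ∃ f ∈ G, x.2 = freeComp S.deg x.1 f := by
    intro x hx
    simp only [H, Finset.mem_biUnion, Finset.mem_image] at hx
    obtain ⟨f, hf, a, _, rfl⟩ := hx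
    exact ⟨f, hf, rfl⟩
  let en := H.equivFin.symm
  refine ⟨H.card, fun q => (en q).1.1, Matrix.of fun p q => (en q).1.2 p, ?_, ?_⟩
  · intro p q m hm
    obtain ⟨f, _, hf⟩ := hH _ (en q).2
    rw [Matrix.of_apply, hf] at hm
    exact shiftComp_support _ _ _ m hm
  · rw [Matrix.range_mulVecLin]
    apply le_antisymm
    · rw [Submodule.span_le]
      rintro _ ⟨q, rfl⟩
      obtain ⟨f, hfG, hf⟩ := hH _ (en q).2
      have hfS : f ∈ S.sub := hG ▸ Submodule.subset_span hfG
      have := S.graded f hfS (en q).1.1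
      rw [← hf] at this
      exact this
    · rw [← hG, Submodule.span_le]
      intro f hf
      have hsum : f = ∑ a ∈ A f, freeComp S.deg a f := by
        funext p
        rw [Finset.sum_apply]
        refine (sum_shiftComp (S.deg p) (f p) (A f) fun m hm => ?_).symm
        simp only [A, Finset.mem_biUnion, Finset.mem_image]
        exact ⟨p, Finset.mem_univ _, m, hm, rfl⟩
      rw [SetLike.mem_coe, hsum]
      refine Submodule.sum_mem _ fun a ha => Submodule.subset_span ?_
      have hx : (a, freeComp S.deg a f) ∈ H := by
        simp only [H, Finset.mem_biUnion, Finset.mem_image]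
        exact ⟨f, hf, a, ha, rfl⟩
      refine ⟨H.equivFin ⟨_, hx⟩, ?_⟩
      funext p
      simp [en, Matrix.col]

theorem graded_ker {r s : ℕ} (deg : Fin r → V →₀ ℕ) (e : Fin s → V →₀ ℕ)
    (D : Matrix (Fin r) (Fin s) (MvPolynomial V k))
    (hD : ∀ p q, ∀ m ∈ (D p q).support, deg p + m = e q) :
    ∀ f ∈ LinearMap.ker D.mulVecLin, ∀ a, freeComp e a f ∈ LinearMap.ker D.mulVecLin := by
  intro f hf a
  rw [LinearMap.mem_ker, Matrix.mulVecLin_apply] at hf ⊢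
  have : D.mulVec (freeComp e a f) = freeComp deg a (D.mulVec f) := by
    funext p
    simp only [Matrix.mulVec, dotProduct, freeComp]
    rw [shiftComp_sum]
    exact Finset.sum_congr rfl fun q _ => (shiftComp_mul _ _ _ _ _ (hD p q)).symm
  rw [this, hf]
  funext p
  exact shiftComp_zero _ _

/-- The graded syzygies on a finite set of homogeneous generators of the given submodule. -/
noncomputable def Stage.next [Finite V] (S : Stage k V) : Stage k V where
  rank := S.exists_generators.choose
  deg := S.exists_generators.choose_spec.choose
  sub := LinearMap.ker S.exists_generators.choose_spec.choose_spec.choose.mulVecLin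
  graded := graded_ker S.deg _ _ S.exists_generators.choose_spec.choose_spec.choose_spec.1

noncomputable def Stage.seq [Finite V] (S : Stage k V) : ℕ → Stage k V
  | 0 => S
  | i + 1 => (Stage.seq S i).next

theorem monomial_mem_graphIdeal (G : SimpleGraph V) (f : MvPolynomial V k)
    (hf : f ∈ graphIdeal k G) (m : V →₀ ℕ) : monomial m (coeff m f) ∈ graphIdeal k G := by
  classical
  have hI : graphIdeal k G = Ideal.span ((fun s => monomial s (1 : k)) ''
      {s | ∃ x y : V, G.Adj x y ∧ s = Finsupp.single x 1 + Finsupp.single y 1}) := by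
    unfold graphIdeal
    congr 1
    ext g
    constructor
    · rintro ⟨x, y, h, rfl⟩
      exact ⟨_, ⟨x, y, h, rfl⟩, by simp [X, monomial_mul]⟩
    · rintro ⟨_, ⟨x, y, h, rfl⟩, rfl⟩
      exact ⟨x, y, h, by simp [X, monomial_mul]⟩
  rw [hI, mem_ideal_span_monomial_image] at hf ⊢
  intro t ht
  have h1 := Finset.mem_singleton.1 (support_monomial_subset ht)
  subst h1
  refine hf t (mem_support_iff.2 fun h => ?_)
  rw [h] at ht
  simp at ht

/-- The residue class ring of a finite graph has a graded free resolution. -/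
theorem nonempty_gradedFreeResolution (k : Type*) [Field k] {V : Type*} [Finite V]
    (G : SimpleGraph V) : Nonempty (GradedFreeResolution (graphIdeal k G)) := by
  classical
  let ε : (Fin 1 → MvPolynomial V k) →ₗ[MvPolynomial V k] MvPolynomial V k ⧸ graphIdeal k G :=
    (graphIdeal k G).mkQ.comp (LinearMap.proj 0)
  have hε : ∀ f, ε f = Ideal.Quotient.mk (graphIdeal k G) (f 0) := fun f => rfl
  let S : Stage k V :=
    { rank := 1
      deg := fun _ => 0
      sub := LinearMap.ker ε
      graded := by
        intro f hf a
        rw [LinearMap.mem_ker, hε, Ideal.Quotient.eq_zero_iff_mem] at hf ⊢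
        simp only [freeComp, shiftComp, zero_le, if_true, tsub_zero]
        exact monomial_mem_graphIdeal G _ hf a }
  have hrange : ∀ i, LinearMap.range
      ((S.seq i).exists_generators.choose_spec.choose_spec.choose.mulVecLin) = (S.seq i).sub :=
    fun i => (S.seq i).exists_generators.choose_spec.choose_spec.choose_spec.2
  exact ⟨{
    rank := fun i => (S.seq i).rank
    deg := fun i => (S.seq i).deg
    d := fun i => (S.seq i).exists_generators.choose_spec.choose_spec.choose
    aug := ε
    homogeneous_d := fun i =>
      (S.seq i).exists_generators.choose_spec.choose_spec.choose_spec.1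
    homogeneous_aug := by
      intro p
      refine ⟨1, ?_⟩
      have hp : p = (0 : Fin 1) := Subsingleton.elim (α := Fin 1) p 0
      subst hp
      change Ideal.Quotient.mk _ ((Pi.single (0 : Fin 1) (1 : MvPolynomial V k) : Fin 1 → _) 0) =
        Ideal.Quotient.mk _ (monomial 0 1)
      simp
    aug_surjective := by
      intro y
      obtain ⟨g, rfl⟩ := Ideal.Quotient.mk_surjective y
      exact ⟨fun _ => g, rfl⟩
    exact_zero := LinearMap.exact_iff.2 (hrange 0).symm
    exact_succ := fun i => LinearMap.exact_iff.2 (hrange (i + 1)).symm }⟩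

end Existence

/-- A graded free resolution of `k[V]/I(G)`. (The dimensions of the modules `Tor` do not depend
on which one is taken.) -/
noncomputable def resolution (k : Type*) [Field k] {V : Type*} [Finite V] (G : SimpleGraph V) :
    GradedFreeResolution (graphIdeal k G) :=
  Classical.choice (nonempty_gradedFreeResolution k G)

/-- The `ℕ^V`-graded Betti number `β_{i,a}(G) = dim_k Tor_i(k[V]/I(G), k)_a`. -/
noncomputable def multiBetti (k : Type*) [Field k] {V : Type*} [Finite V] (G : SimpleGraph V)
    (i : ℕ) (a : V →₀ ℕ) : ℕ :=
  Module.finrank k ((resolution k G).Tor i a)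

/-- The `ℕ`-graded Betti number `β_{i,d}(G) = ∑_{|a| = d} β_{i,a}(G)`, with the convention that
it is zero if `i < 0` or `d < 0`. -/
noncomputable def betti (k : Type*) [Field k] {V : Type*} [Finite V] (G : SimpleGraph V) :
    ℤ → ℤ → ℕ
  | Int.ofNat i, Int.ofNat d => ∑ᶠ (a : V →₀ ℕ) (_ : a.degree = d), multiBetti k G i a
  | _, _ => 0

end GraphBetti

/-! Write x for the leaf v₁ and W for the remaining neighbours of v. Over R, let M' = R/I(T')R.
Since v is the only neighbour of x, I(T) = I(T')R + (vx), so there is a short exact sequence 0 → N →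
M' → R/I(T) → 0 with N = vx·M'. Multiplication by vx identifies N, up to a shift by the degree of
vx, with R/(I(T')R : vx), and this colon ideal is I(T'')R + (w : w ∈ W): the edges vw contribute the
variables w, and every other edge of T' that meets a neighbour of v becomes redundant.

A mapping cone over N → M' resolves R/I(T). No cancellation occurs in its homology after tensoring
with k: the generators in the resolution of M' have x-degree 0, those in the resolution of N have
x-degree at least 1. Hence Betti numbers add, with homological shift 1 and internal shift 2. The
same argument for multiplication by each w ∈ W, which does not occur in a resolution of R/I(T''),
yields Pascal's recursion and therefore the binomial coefficients (`Resolves.exists_quotient`).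

All modules involved have dimension at most one in each degree, so they are recorded by the set of
degrees in which they are nonzero. Setting the variables equal to 1 turns a graded resolution into
scalar matrices that respect the order of degrees; the degree a part of a free module becomes the
span of the basis elements of degree ≤ a, and its part tensored with k the span of those of degree
exactly a. The comparison theorem in this language (`Resolves.betti_eq`) makes Betti numbers
independent of the resolution, `Resolves.cone` supplies the cones, `betti_cone` the additivity, and
`GradedFreeResolution.resolves` the passage from polynomial matrices. `betti_eq_of_leaf` assembles
the sequence above. -/

namespace GraphBetti

open scoped Matrix

/-! ### Triangular matrices over a poset and their diagonal blocks -/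

section Triangular

variable {k : Type*} [Field k] {P : Type*} {l m n : Type*}

section Order

variable [PartialOrder P]

/-- A matrix between free modules with bases graded by a poset is triangular if it maps every
basis element to a combination of basis elements of smaller or equal degree. -/
def Triangular (e : l → P) (f : m → P) (A : Matrix l m k) : Prop :=
  ∀ p q, A p q ≠ 0 → e p ≤ f q

/-- The span of the basis elements of degree at most `a`. -/
def below (k : Type*) [Field k] (e : m → P) (a : P) : Submodule k (m → k) where
  carrier := {x | ∀ p, x p ≠ 0 → e p ≤ a}
  add_mem' := by
    intro x y hx hy p hp
    by_cases h : x p = 0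
    · exact hy p (by simpa [h] using hp)
    · exact hx p h
  zero_mem' := by intro p hp; exact absurd rfl hp
  smul_mem' := by
    intro c x hx p hp
    exact hx p fun h => hp (by simp [h])

theorem single_mem_below [DecidableEq m] (f : m → P) (q : m) (c : k) :
    Pi.single q c ∈ below k f (f q) := by
  intro p hp
  by_cases h : p = q
  · rw [h]
  · exact absurd (Pi.single_eq_of_ne (M := fun _ => k) h c) hp

theorem Triangular.mulVec_mem {e : l → P} {f : m → P} {A : Matrix l m k} [Fintype m]
    (hA : Triangular e f A) {a : P} {x : m → k} (hx : x ∈ below k f a) :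
    A *ᵥ x ∈ below k e a := by
  intro p hp
  obtain ⟨q, -, hq⟩ := Finset.exists_ne_zero_of_sum_ne_zero hp
  exact (hA p q (left_ne_zero_of_mul hq)).trans (hx q (right_ne_zero_of_mul hq))

theorem Triangular.col_mem {e : m → P} {f : n → P} {A : Matrix m n k}
    (hA : Triangular e f A) (q : n) : A.col q ∈ below k e (f q) := fun p hp => hA p q hp

theorem Triangular.mul [Fintype m] {e : l → P} {f : m → P} {g : n → P} {A : Matrix l m k}
    {B : Matrix m n k} (hA : Triangular e f A) (hB : Triangular f g B) :
    Triangular e g (A * B) := by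
  intro p r h
  obtain ⟨q, -, hq⟩ := Finset.exists_ne_zero_of_sum_ne_zero h
  exact (hA p q (left_ne_zero_of_mul hq)).trans (hB q r (right_ne_zero_of_mul hq))

theorem Triangular.add {e : l → P} {f : m → P} {A B : Matrix l m k}
    (hA : Triangular e f A) (hB : Triangular e f B) : Triangular e f (A + B) := by
  intro p q h
  by_cases h0 : A p q = 0
  · exact hB p q (by simpa [h0] using h)
  · exact hA p q h0

theorem Triangular.neg {e : l → P} {f : m → P} {A : Matrix l m k}
    (hA : Triangular e f A) : Triangular e f (-A) :=
  fun p q h => hA p q (by simpa using h)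

theorem Triangular.sub {e : l → P} {f : m → P} {A B : Matrix l m k}
    (hA : Triangular e f A) (hB : Triangular e f B) : Triangular e f (A - B) :=
  sub_eq_add_neg A B ▸ hA.add hB.neg

theorem triangular_one [DecidableEq m] (e : m → P) : Triangular e e (1 : Matrix m m k) := by
  intro p q h
  rw [Matrix.one_apply] at h
  split_ifs at h with hpq
  · rw [hpq]
  · exact absurd rfl h

theorem col_mul [Fintype m] (A : Matrix l m k) (B : Matrix m n k) (q : n) :
    (A * B).col q = A *ᵥ B.col q := rfl

/-- A triangular matrix factors through a triangular matrix if its columns are in the image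
degree by degree. -/
theorem exists_triangular_mul_eq [Fintype m] {f : m → P} {g : n → P} (A : Matrix l m k)
    (B : Matrix l n k) (h : ∀ q, ∃ y ∈ below k f (g q), A *ᵥ y = B.col q) :
    ∃ X : Matrix m n k, Triangular f g X ∧ A * X = B := by
  choose y hy hAy using h
  refine ⟨Matrix.of fun p q => y q p, fun p q hpq => hy q p hpq, ?_⟩
  ext p q
  exact congrFun (hAy q) p

end Order

/-- The block of a matrix in degree `a`. -/
def block (e : l → P) (f : m → P) (a : P) (A : Matrix l m k) :
    Matrix {p // e p = a} {q // f q = a} k :=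
  A.submatrix Subtype.val Subtype.val

-- An intermediate index contributing to an entry in degree a has its degree squeezed between a and
-- a by triangularity, so only the diagonal blocks interact. This is what makes tensoring with k
-- functorial here.
open scoped Classical in
theorem block_mul [PartialOrder P] [Fintype m] {e : l → P} {f : m → P} {g : n → P}
    {A : Matrix l m k} {B : Matrix m n k}
    (hA : Triangular e f A) (hB : Triangular f g B) (a : P) :
    block e g a (A * B) = block e f a A * block f g a B := by
  ext ⟨p, hp⟩ ⟨r, hr⟩
  simp only [block, Matrix.submatrix_apply, Matrix.mul_apply]
  rw [← Finset.sum_subtype (Finset.univ.filter fun q => f q = a) (by simp)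
    (fun q => A p q * B q r)]
  refine (Finset.sum_subset (Finset.subset_univ _) fun q _ hq => ?_).symm
  by_contra h
  refine hq (Finset.mem_filter.2 ⟨Finset.mem_univ q, le_antisymm ?_ ?_⟩)
  · exact hr ▸ hB q r (right_ne_zero_of_mul h)
  · exact hp ▸ hA p q (left_ne_zero_of_mul h)

theorem block_add (e : l → P) (f : m → P) (A B : Matrix l m k) (a : P) :
    block e f a (A + B) = block e f a A + block e f a B := rfl

theorem block_one [DecidableEq m] (e : m → P) (a : P) :
    block e e a (1 : Matrix m m k) = 1 :=
  Matrix.submatrix_one _ Subtype.val_injective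

end Triangular

/-! ### Poset-graded complexes, lifting of maps and homotopies -/

/-- A chain complex of free modules of finite rank with bases graded by a poset. -/
structure PosetComplex (k : Type*) [Field k] (P : Type*) [PartialOrder P] where
  ι : ℕ → Type
  [fintype : ∀ i, Fintype (ι i)]
  deg : ∀ i, ι i → P
  d : ∀ i, Matrix (ι i) (ι (i + 1)) k
  triangular : ∀ i, Triangular (deg i) (deg (i + 1)) (d i)
  d_mul_d : ∀ i, d i * d (i + 1) = 0

attribute [instance] PosetComplex.fintype

namespace PosetComplex

variable {k : Type*} [Field k] {P : Type*} [PartialOrder P]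

/-- The differential of the degree `a` part of a complex. -/
def strand (F : PosetComplex k P) (i : ℕ) (a : P) :
    Matrix {p // F.deg i p = a} {q // F.deg (i + 1) q = a} k :=
  block (F.deg i) (F.deg (i + 1)) a (F.d i)

open scoped Classical in
/-- The cycles of the degree `a` part of a complex. -/
noncomputable def cycles (F : PosetComplex k P) (a : P) :
    (i : ℕ) → Submodule k ({p // F.deg i p = a} → k)
  | 0 => ⊤
  | i + 1 => LinearMap.ker (F.strand i a).mulVecLin

open scoped Classical in
/-- The boundaries of the degree `a` part of a complex. -/
noncomputable def boundaries (F : PosetComplex k P) (a : P) (i : ℕ) :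
    Submodule k ({p // F.deg i p = a} → k) :=
  LinearMap.range (F.strand i a).mulVecLin

/-- The dimension of the homology of the degree `a` part of a complex. -/
noncomputable def betti (F : PosetComplex k P) (i : ℕ) (a : P) : ℕ :=
  Module.finrank k (F.cycles a i ⧸ (F.boundaries a i).submoduleOf (F.cycles a i))

/-- The complex `F` is a free resolution of the module that is one-dimensional in the degrees
belonging to `S` and zero in the other degrees. -/
structure Resolves (F : PosetComplex k P) (S : Set P) (ε : F.ι 0 → k) : Prop where
  eps_eq_zero : ∀ p, F.deg 0 p ∉ S → ε p = 0
  exists_eps_eq_one : ∀ a ∈ S, ∃ x ∈ below k (F.deg 0) a, ε ⬝ᵥ x = 1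
  eps_d : ∀ a ∈ S, ∀ y ∈ below k (F.deg 1) a, ε ⬝ᵥ F.d 0 *ᵥ y = 0
  exact_zero : ∀ a, ∀ x ∈ below k (F.deg 0) a, (a ∈ S → ε ⬝ᵥ x = 0) →
    ∃ y ∈ below k (F.deg 1) a, F.d 0 *ᵥ y = x
  exact_succ : ∀ i a, ∀ x ∈ below k (F.deg (i + 1)) a, F.d i *ᵥ x = 0 →
    ∃ y ∈ below k (F.deg (i + 2)) a, F.d (i + 1) *ᵥ y = x

/-- Triangular chain maps. -/
structure Hom (F G : PosetComplex k P) where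
  f : ∀ i, Matrix (G.ι i) (F.ι i) k
  triangular : ∀ i, Triangular (G.deg i) (F.deg i) (f i)
  comm : ∀ i, G.d i * f (i + 1) = f i * F.d i

/-- Dependent choice, used to build chain maps and homotopies one degree at a time: Q is the
invariant that makes the next choice possible, R the relation between consecutive choices. -/
theorem exists_seq {α : ℕ → Type*} (Q : ∀ i, α i → Prop) (R : ∀ i, α i → α (i + 1) → Prop)
    {x : α 0} (hx : Q 0 x) (h : ∀ i x, Q i x → ∃ y, Q (i + 1) y ∧ R i x y) :
    ∃ s : ∀ i, α i, s 0 = x ∧ (∀ i, Q i (s i)) ∧ ∀ i, R i (s i) (s (i + 1)) := by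
  choose next hQ hR using h
  let t : ∀ i, {x : α i // Q i x} := fun i =>
    Nat.rec ⟨x, hx⟩ (fun i y => ⟨next i y.1 y.2, hQ i y.1 y.2⟩) i
  exact ⟨fun i => (t i).1, rfl, fun i => (t i).2, fun i => hR i (t i).1 (t i).2⟩

variable {F G : PosetComplex k P} {S S' : Set P} {ε : F.ι 0 → k} {η : G.ι 0 → k}

/-- An inclusion of modules lifts to a chain map of resolutions. -/
theorem Resolves.exists_hom (hF : F.Resolves S ε) (hG : G.Resolves S' η) (hS : S ⊆ S')
    (hup : ∀ a ∈ S, ∀ b ∈ S', a ≤ b → b ∈ S) :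
    ∃ φ : Hom F G, η ᵥ* φ.f 0 = ε := by
  have h0 : ∃ X : Matrix (G.ι 0) (F.ι 0) k,
      Triangular (G.deg 0) (F.deg 0) X ∧ η ᵥ* X = ε := by
    have : ∀ q, ∃ x ∈ below k (G.deg 0) (F.deg 0 q), η ⬝ᵥ x = ε q := by
      intro q
      by_cases hq : F.deg 0 q ∈ S
      · obtain ⟨x, hx, h1⟩ := hG.exists_eps_eq_one _ (hS hq)
        exact ⟨ε q • x, Submodule.smul_mem _ _ hx, by simp [h1]⟩
      · exact ⟨0, Submodule.zero_mem _, by simp [hF.eps_eq_zero q hq]⟩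
    choose x hx hεx using this
    exact ⟨Matrix.of fun p q => x q p, fun p q h => hx q p h, funext hεx⟩
  obtain ⟨X, hX, hηX⟩ := h0
  -- For degrees in S this is `eps_d`. For degrees in S' outside S, a nonzero term would come from a
  -- generator with degree in S lying below, contradicting that S is upward closed in S'.
  have hεd : ∀ q, F.deg 1 q ∈ S' → ε ⬝ᵥ (F.d 0).col q = 0 := by
    intro q hq
    by_cases hqS : F.deg 1 q ∈ S
    · classical
      have h1 := hF.eps_d _ hqS _ (single_mem_below (F.deg 1) q (1 : k))
      rwa [Matrix.mulVec_single_one] at h1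
    · refine Finset.sum_eq_zero fun p _ => ?_
      by_contra h
      exact hqS (hup _ (by_contra fun hp => left_ne_zero_of_mul h (hF.eps_eq_zero p hp)) _ hq
        (F.triangular 0 p q (right_ne_zero_of_mul h)))
  -- The invariant includes that the columns of Y * F.d i are boundaries of G in the right degrees,
  -- so that the next component exists; exactness of G propagates it.
  obtain ⟨s, hs0, hs, hs'⟩ := exists_seq (α := fun i => Matrix (G.ι i) (F.ι i) k)
    (fun i Y => Triangular (G.deg i) (F.deg i) Y ∧
      (∀ q, ∃ y ∈ below k (G.deg (i + 1)) (F.deg (i + 1) q),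
        G.d i *ᵥ y = (Y * F.d i).col q))
    (fun i Y Z => G.d i * Z = Y * F.d i)
    (by
      refine ⟨hX, fun q => ?_⟩
      refine hG.exact_zero _ _ ((hX.mul (F.triangular 0)).col_mem q) fun hq => ?_
      rw [col_mul, Matrix.dotProduct_mulVec, hηX, hεd q hq])
    (by
      rintro i Y ⟨hY, hY'⟩
      obtain ⟨Z, hZ, hZ'⟩ := exists_triangular_mul_eq (G.d i) (Y * F.d i) hY'
      refine ⟨Z, ⟨hZ, fun q => ?_⟩, hZ'⟩
      refine hG.exact_succ i _ _ ((hZ.mul (F.triangular (i + 1))).col_mem q) ?_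
      rw [← col_mul, ← Matrix.mul_assoc, hZ', Matrix.mul_assoc, F.d_mul_d, Matrix.mul_zero]
      rfl)
  exact ⟨⟨s, fun i => (hs i).1, hs'⟩, by rw [← hηX, ← hs0]⟩

/-- A chain map from a complex to a resolution that vanishes on the resolved module is
null-homotopic. -/
theorem Resolves.exists_homotopy (hG : G.Resolves S η) (φ : ∀ i, Matrix (G.ι i) (F.ι i) k)
    (hφ : ∀ i, Triangular (G.deg i) (F.deg i) (φ i))
    (hcomm : ∀ i, G.d i * φ (i + 1) = φ i * F.d i) (h0 : η ᵥ* φ 0 = 0) :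
    ∃ h : ∀ i, Matrix (G.ι (i + 1)) (F.ι i) k,
      (∀ i, Triangular (G.deg (i + 1)) (F.deg i) (h i)) ∧ φ 0 = G.d 0 * h 0 ∧
        ∀ i, φ (i + 1) = G.d (i + 1) * h (i + 1) + h i * F.d i := by
  obtain ⟨H, hH, hH'⟩ := exists_triangular_mul_eq (f := G.deg 1) (g := F.deg 0)
    (G.d 0) (φ 0) fun q => by
      refine hG.exact_zero _ _ ((hφ 0).col_mem q) fun _ => ?_
      exact congrFun h0 q
  -- The invariant says that the error left by the homotopy so far consists of cycles, which
  -- exactness of G turns into boundaries.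
  obtain ⟨s, hs0, hs, hs'⟩ := exists_seq (α := fun i => Matrix (G.ι (i + 1)) (F.ι i) k)
    (fun i Y => Triangular (G.deg (i + 1)) (F.deg i) Y ∧
      G.d i * (φ (i + 1) - Y * F.d i) = 0)
    (fun i Y Z => φ (i + 1) = G.d (i + 1) * Z + Y * F.d i)
    (by
      refine ⟨hH, ?_⟩
      rw [Matrix.mul_sub, ← Matrix.mul_assoc, hH', hcomm, sub_self])
    (by
      rintro i Y ⟨hY, hY'⟩
      have ht : Triangular (G.deg (i + 1)) (F.deg (i + 1)) (φ (i + 1) - Y * F.d i) :=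
        (hφ _).sub (hY.mul (F.triangular i))
      obtain ⟨Z, hZ, hZ'⟩ := exists_triangular_mul_eq (f := G.deg (i + 2)) (g := F.deg (i + 1))
        (G.d (i + 1)) (φ (i + 1) - Y * F.d i) fun q => by
          refine hG.exact_succ i _ _ (ht.col_mem q) ?_
          rw [← col_mul, hY']
          rfl
      refine ⟨Z, ⟨hZ, ?_⟩, by rw [hZ', sub_add_cancel]⟩
      rw [Matrix.mul_sub, ← Matrix.mul_assoc, hZ', hcomm, Matrix.sub_mul, Matrix.mul_assoc Y,
        F.d_mul_d, Matrix.mul_zero, sub_zero, sub_self])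
  refine ⟨s, fun i => (hs i).1, ?_, hs'⟩
  rw [hs0, hH']

end PosetComplex

/-! ### Betti numbers do not depend on the resolution -/

/-- The first two conditions let f descend to the subquotients; the third makes the induced map
injective. -/
theorem finrank_subquotient_le {k X Y : Type*} [Field k] [AddCommGroup X] [Module k X]
    [AddCommGroup Y] [Module k Y] [FiniteDimensional k Y] (f : X →ₗ[k] Y) {Z B : Submodule k X}
    {Z' B' : Submodule k Y} (hZ : ∀ x ∈ Z, f x ∈ Z') (hB : ∀ x ∈ B, f x ∈ B')
    (h : ∀ x ∈ Z, f x ∈ B' → x ∈ B) :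
    Module.finrank k (Z ⧸ B.submoduleOf Z) ≤ Module.finrank k (Z' ⧸ B'.submoduleOf Z') := by
  have hB' : B.submoduleOf Z ≤ (B'.submoduleOf Z').comap (f.restrict hZ) :=
    fun x hx => hB x hx
  refine LinearMap.finrank_le_finrank_of_injective
    (f := Submodule.mapQ (B.submoduleOf Z) (B'.submoduleOf Z') (f.restrict hZ) hB') ?_
  rw [injective_iff_map_eq_zero]
  intro x hx
  obtain ⟨z, rfl⟩ := Submodule.Quotient.mk_surjective _ x
  rw [Submodule.mapQ_apply, Submodule.Quotient.mk_eq_zero] at hx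
  rw [Submodule.Quotient.mk_eq_zero]
  exact h z z.2 hx

namespace PosetComplex

variable {k : Type*} [Field k] {P : Type*} [PartialOrder P]
variable {F G : PosetComplex k P} {S S' : Set P} {ε : F.ι 0 → k} {η : G.ι 0 → k}

-- Lift the identity of the resolved module to φ : F → G and ψ : G → F. Then ψφ − 1 is
-- null-homotopic, and this survives restriction to degree a blocks, so φ is injective on homology.
open scoped Classical in
theorem Resolves.betti_le (hF : F.Resolves S ε) (hG : G.Resolves S η) (i : ℕ) (a : P) :
    F.betti i a ≤ G.betti i a := by
  obtain ⟨φ, hφ⟩ := hF.exists_hom hG subset_rfl fun _ _ _ h _ => h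
  obtain ⟨ψ, hψ⟩ := hG.exists_hom hF subset_rfl fun _ _ _ h _ => h
  obtain ⟨h, hh, hh0, hh1⟩ := hF.exists_homotopy (fun i => ψ.f i * φ.f i - 1)
    (fun i => ((ψ.triangular i).mul (φ.triangular i)).sub (triangular_one _))
    (fun i => by
      rw [Matrix.mul_sub, ← Matrix.mul_assoc, ψ.comm, Matrix.mul_assoc, φ.comm, Matrix.sub_mul,
        Matrix.mul_one, Matrix.one_mul, Matrix.mul_assoc])
    (by rw [Matrix.vecMul_sub, ← Matrix.vecMul_vecMul, hψ, hφ, Matrix.vecMul_one, sub_self])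
  let φ' := fun i => block (G.deg i) (F.deg i) a (φ.f i)
  let ψ' := fun i => block (F.deg i) (G.deg i) a (ψ.f i)
  let h' := fun i => block (F.deg (i + 1)) (F.deg i) a (h i)
  have hφ' : ∀ i, G.strand i a * φ' (i + 1) = φ' i * F.strand i a := fun i => by
    simp only [φ', strand]
    rw [← block_mul (G.triangular i) (φ.triangular _), φ.comm,
      block_mul (φ.triangular i) (F.triangular _)]
  have hψ' : ∀ i, F.strand i a * ψ' (i + 1) = ψ' i * G.strand i a := fun i => by
    simp only [ψ', strand]
    rw [← block_mul (F.triangular i) (ψ.triangular _), ψ.comm,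
      block_mul (ψ.triangular i) (G.triangular _)]
  have hh0' : ψ' 0 * φ' 0 = F.strand 0 a * h' 0 + 1 := by
    simp only [ψ', φ', h', strand]
    rw [← block_mul (ψ.triangular _) (φ.triangular _), ← block_mul (F.triangular _) (hh _),
      ← block_one (F.deg 0), ← block_add, ← hh0, sub_add_cancel]
  have hh1' : ∀ i, ψ' (i + 1) * φ' (i + 1) =
      F.strand (i + 1) a * h' (i + 1) + h' i * F.strand i a + 1 := fun i => by
    simp only [ψ', φ', h', strand]
    rw [← block_mul (ψ.triangular _) (φ.triangular _), ← block_mul (F.triangular _) (hh _),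
      ← block_mul (hh _) (F.triangular _), ← block_one (F.deg (i + 1)), ← block_add, ← block_add,
      ← hh1, sub_add_cancel]
  refine finrank_subquotient_le (φ' i).mulVecLin ?_ ?_ ?_
  · cases i with
    | zero => exact fun _ _ => Submodule.mem_top
    | succ i =>
      intro x hx
      change F.strand i a *ᵥ x = 0 at hx
      change G.strand i a *ᵥ φ' (i + 1) *ᵥ x = 0
      rw [Matrix.mulVec_mulVec, hφ', ← Matrix.mulVec_mulVec, hx, Matrix.mulVec_zero]
  · rintro _ ⟨w, rfl⟩
    refine ⟨φ' (i + 1) *ᵥ w, ?_⟩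
    change G.strand i a *ᵥ φ' (i + 1) *ᵥ w = φ' i *ᵥ F.strand i a *ᵥ w
    rw [Matrix.mulVec_mulVec, Matrix.mulVec_mulVec, hφ']
  · rintro x hx ⟨w, hw⟩
    change G.strand i a *ᵥ w = φ' i *ᵥ x at hw
    -- If φx = ∂w, then ∂ψw = ψφx = x + ∂hx for a cycle x, so x = ∂(ψw − hx).
    refine ⟨ψ' (i + 1) *ᵥ w - h' i *ᵥ x, ?_⟩
    change F.strand i a *ᵥ (ψ' (i + 1) *ᵥ w - h' i *ᵥ x) = x
    rw [Matrix.mulVec_sub, Matrix.mulVec_mulVec, hψ', ← Matrix.mulVec_mulVec, hw,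
      Matrix.mulVec_mulVec, Matrix.mulVec_mulVec]
    cases i with
    | zero => rw [hh0', Matrix.add_mulVec, Matrix.one_mulVec, add_sub_cancel_left]
    | succ i =>
      change F.strand i a *ᵥ x = 0 at hx
      rw [hh1', Matrix.add_mulVec, Matrix.add_mulVec, Matrix.one_mulVec, ← Matrix.mulVec_mulVec x
        (h' i), hx, Matrix.mulVec_zero, add_zero, add_sub_cancel_left]

/-- The homology of the graded parts of a resolution depends only on the resolved module. -/
theorem Resolves.betti_eq (hF : F.Resolves S ε) (hG : G.Resolves S η) (i : ℕ) (a : P) :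
    F.betti i a = G.betti i a :=
  le_antisymm (hF.betti_le hG i a) (hG.betti_le hF i a)

/-! ### Change of grading, and Betti numbers through ranks -/

/-- The complex obtained by changing the degrees along a monotone map. -/
def mapDeg (F : PosetComplex k P) {Q : Type*} [PartialOrder Q] (s : P → Q) (hs : Monotone s) :
    PosetComplex k Q where
  ι := F.ι
  deg := fun i p => s (F.deg i p)
  d := F.d
  triangular := fun i p q h => hs (F.triangular i p q h)
  d_mul_d := F.d_mul_d

section mapDeg

variable {Q : Type*} [PartialOrder Q] {s : P → Q} (hs : Monotone s)

/-- Resolving is tested one degree a at a time. Either the elements b with s b ≤ a are exactly those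
below some a', and the conditions at a are those of F at a', or there are none and the free modules
vanish in degree a. -/
theorem Resolves.mapDeg (hF : F.Resolves S ε) {S' : Set Q} (hS : ∀ b ∈ S, s b ∈ S')
    (h : ∀ a, (∃ a', (∀ b, s b ≤ a ↔ b ≤ a') ∧ (a ∈ S' ↔ a' ∈ S)) ∨
      ((∀ b, ¬ s b ≤ a) ∧ a ∉ S')) :
    (F.mapDeg s hs).Resolves S' ε := by
  have h1 : ∀ {a a'}, (∀ b, s b ≤ a ↔ b ≤ a') → ∀ i,
      below k ((F.mapDeg s hs).deg i) a = below k (F.deg i) a' := by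
    intro a a' h i
    ext x
    exact forall₂_congr fun p _ => h _
  have h2 : ∀ {a}, (∀ b, ¬ s b ≤ a) → ∀ i, ∀ x ∈ below k ((F.mapDeg s hs).deg i) a, x = 0 := by
    intro a h i x hx
    funext p
    exact by_contra fun hp => h _ (hx p hp)
  refine ⟨fun p hp => hF.eps_eq_zero p fun h => hp (hS _ h), ?_, ?_, ?_, ?_⟩
  · intro a ha
    rcases h a with ⟨a', h3, h4⟩ | ⟨-, h3⟩
    · rw [h1 h3]
      exact hF.exists_eps_eq_one a' (h4.1 ha)
    · exact absurd ha h3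
  · intro a ha
    rcases h a with ⟨a', h3, h4⟩ | ⟨-, h3⟩
    · rw [h1 h3]
      exact hF.eps_d a' (h4.1 ha)
    · exact absurd ha h3
  · intro a x hx hx'
    rcases h a with ⟨a', h3, h4⟩ | ⟨h3, -⟩
    · rw [h1 h3] at hx ⊢
      exact hF.exact_zero a' x hx fun h => hx' (h4.2 h)
    · exact ⟨0, Submodule.zero_mem _, by rw [h2 h3 0 x hx, Matrix.mulVec_zero]⟩
  · intro i a x hx hx'
    rcases h a with ⟨a', h3, -⟩ | ⟨h3, -⟩
    · rw [h1 h3] at hx ⊢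
      exact hF.exact_succ i a' x hx hx'
    · exact ⟨0, Submodule.zero_mem _, by rw [h2 h3 _ x hx, Matrix.mulVec_zero]⟩

end mapDeg

theorem betti_eq_zero (F : PosetComplex k P) {i : ℕ} {a : P} (h : ∀ p, F.deg i p ≠ a) :
    F.betti i a = 0 := by
  have : IsEmpty {p // F.deg i p = a} := ⟨fun p => h p.1 p.2⟩
  have : Subsingleton (F.cycles a i ⧸ (F.boundaries a i).submoduleOf (F.cycles a i)) := by
    infer_instance
  exact Module.finrank_zero_of_subsingleton

theorem finrank_subquotient_add {X : Type*} [AddCommGroup X] [Module k X]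
    [FiniteDimensional k X] {B Z : Submodule k X} (h : B ≤ Z) :
    Module.finrank k (Z ⧸ B.submoduleOf Z) + Module.finrank k B = Module.finrank k Z := by
  rw [← (Submodule.submoduleOfEquivOfLe h).finrank_eq]
  exact Submodule.finrank_quotient_add_finrank _

open scoped Classical in
theorem betti_add_rank_zero (F : PosetComplex k P) (a : P) :
    F.betti 0 a + (F.strand 0 a).rank = Fintype.card {p // F.deg 0 p = a} := by
  rw [betti, Matrix.rank]
  refine (finrank_subquotient_add (B := F.boundaries a 0) (Z := F.cycles a 0) le_top).trans ?_
  rw [cycles, finrank_top, Module.finrank_fintype_fun_eq_card]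

-- Rank-nullity for the strand. Betti numbers are thereby determined by block ranks and basis
-- counts, so later comparisons of complexes reduce to comparing these.
open scoped Classical in
theorem betti_add_rank_succ (F : PosetComplex k P) (i : ℕ) (a : P) :
    F.betti (i + 1) a + (F.strand (i + 1) a).rank + (F.strand i a).rank =
      Fintype.card {p // F.deg (i + 1) p = a} := by
  have hle : F.boundaries a (i + 1) ≤ F.cycles a (i + 1) := by
    rintro _ ⟨x, rfl⟩
    change F.strand i a *ᵥ F.strand (i + 1) a *ᵥ x = 0
    rw [Matrix.mulVec_mulVec, strand, strand, ← block_mul (F.triangular _) (F.triangular _),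
      F.d_mul_d]
    exact Matrix.zero_mulVec x
  have h := finrank_subquotient_add hle
  have h' := (F.strand i a).mulVecLin.finrank_range_add_finrank_ker
  rw [Module.finrank_fintype_fun_eq_card] at h'
  rw [← h', betti, Matrix.rank, Matrix.rank, add_comm (Module.finrank k (LinearMap.range _))]
  exact congrArg (· + _) h

theorem betti_mapDeg (F : PosetComplex k P) {Q : Type*} [PartialOrder Q] {s : P → Q}
    (hs : Monotone s) (hinj : Function.Injective s) (i : ℕ) (a : P) :
    (F.mapDeg s hs).betti i (s a) = F.betti i a := by
  classical
  let e : ∀ i, {p // (F.mapDeg s hs).deg i p = s a} ≃ {p // F.deg i p = a} := fun i =>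
    Equiv.subtypeEquivRight fun p => hinj.eq_iff
  have hr : ∀ i, ((F.mapDeg s hs).strand i (s a)).rank = (F.strand i a).rank := fun i =>
    Matrix.rank_submatrix (F.strand i a) (e i) (e (i + 1))
  cases i with
  | zero =>
    have h1 := F.betti_add_rank_zero a
    have h2 := (F.mapDeg s hs).betti_add_rank_zero (s a)
    rw [Fintype.card_congr (e 0), hr] at h2
    omega
  | succ i =>
    have h1 := F.betti_add_rank_succ i a
    have h2 := (F.mapDeg s hs).betti_add_rank_succ i (s a)
    rw [Fintype.card_congr (e (i + 1)), hr, hr] at h2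
    omega

end PosetComplex

/-! ### Shifts and mapping cones -/

theorem rank_neg {k m n : Type*} [Field k] [Fintype n] (A : Matrix m n k) :
    (-A).rank = A.rank := by
  have : (-A).mulVecLin = -A.mulVecLin := by
    ext x
    simp
  rw [Matrix.rank, this, LinearMap.range_neg, Matrix.rank]

theorem fromBlocks_eq_zero {k l m n o : Type*} [Zero k] {A : Matrix n l k} {B : Matrix n m k}
    {C : Matrix o l k} {D : Matrix o m k} (hA : A = 0) (hB : B = 0) (hC : C = 0) (hD : D = 0) :
    Matrix.fromBlocks A B C D = 0 := by
  rw [hA, hB, hC, hD, Matrix.fromBlocks_zero]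

theorem finrank_submodule_prod {k X Y : Type*} [Field k] [AddCommGroup X] [Module k X]
    [AddCommGroup Y] [Module k Y] [FiniteDimensional k X] [FiniteDimensional k Y]
    (p : Submodule k X) (q : Submodule k Y) :
    Module.finrank k (p.prod q) = Module.finrank k p + Module.finrank k q := by
  have h : p.prod q = LinearMap.range (p.subtype.prodMap q.subtype) := by
    rw [LinearMap.range_prodMap, Submodule.range_subtype, Submodule.range_subtype]
  rw [h, LinearMap.finrank_range_of_inj
    (Function.Injective.prodMap p.injective_subtype q.injective_subtype), Module.finrank_prod]

theorem rank_fromBlocks_diagonal {k m n m' n' : Type*} [Field k] [Fintype m] [Fintype n]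
    [Fintype m'] [Fintype n'] (A : Matrix m n k) (D : Matrix m' n' k) :
    (Matrix.fromBlocks A 0 0 D).rank = A.rank + D.rank := by
  let e := LinearEquiv.sumArrowLequivProdArrow m m' k k
  let e' := LinearEquiv.sumArrowLequivProdArrow n n' k k
  have h : (Matrix.fromBlocks A 0 0 D).mulVecLin =
      e.symm.toLinearMap ∘ₗ (A.mulVecLin.prodMap D.mulVecLin) ∘ₗ e'.toLinearMap := by
    refine LinearMap.ext fun x => ?_
    change Matrix.fromBlocks A 0 0 D *ᵥ x = Sum.elim (A *ᵥ (x ∘ Sum.inl)) (D *ᵥ (x ∘ Sum.inr))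
    rw [Matrix.fromBlocks_mulVec, Matrix.zero_mulVec, Matrix.zero_mulVec, add_zero, zero_add]
  rw [Matrix.rank, h, LinearMap.range_comp, LinearEquiv.finrank_map_eq,
    LinearMap.range_comp_of_range_eq_top _ (LinearEquiv.range e'), LinearMap.range_prodMap,
    finrank_submodule_prod, Matrix.rank, Matrix.rank]

namespace PosetComplex

variable {k : Type*} [Field k] {P : Type*} [PartialOrder P]

/-- The basis of a complex that is shifted by one. -/
def shiftBasis (F : PosetComplex k P) : ℕ → Type
  | 0 => Empty
  | i + 1 => F.ι i

instance (F : PosetComplex k P) : ∀ i, Fintype (F.shiftBasis i)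
  | 0 => inferInstanceAs (Fintype Empty)
  | i + 1 => inferInstanceAs (Fintype (F.ι i))

/-- The complex `F[1]`. -/
def shift (F : PosetComplex k P) : PosetComplex k P where
  ι := F.shiftBasis
  deg
    | 0 => Empty.elim
    | i + 1 => F.deg i
  d
    | 0 => 0
    | i + 1 => -F.d i
  triangular
    | 0 => fun p _ _ => p.elim
    | i + 1 => (F.triangular i).neg
  d_mul_d
    | 0 => Matrix.zero_mul _
    | i + 1 => by
      change -F.d i * -F.d (i + 1) = 0
      rw [Matrix.neg_mul, Matrix.mul_neg, F.d_mul_d, neg_zero, neg_zero]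

theorem betti_shift_zero (F : PosetComplex k P) (a : P) : F.shift.betti 0 a = 0 :=
  betti_eq_zero _ fun p => p.elim

theorem betti_shift_succ (F : PosetComplex k P) (i : ℕ) (a : P) :
    F.shift.betti (i + 1) a = F.betti i a := by
  classical
  have hr : ∀ i, (F.shift.strand (i + 1) a).rank = (F.strand i a).rank := fun i =>
    rank_neg (F.strand i a)
  have hr0 : (F.shift.strand 0 a).rank = 0 := by
    have : F.shift.strand 0 a = 0 := rfl
    rw [this, Matrix.rank_zero]
  have hc : ∀ i, Fintype.card {p // F.shift.deg (i + 1) p = a} =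
    Fintype.card {p // F.deg i p = a} := fun i => rfl
  have h2 := F.shift.betti_add_rank_succ i a
  rw [hr, hc] at h2
  cases i with
  | zero =>
    have h1 := F.betti_add_rank_zero a
    rw [hr0] at h2
    omega
  | succ i =>
    have h1 := F.betti_add_rank_succ i a
    rw [hr] at h2
    omega

/-- The mapping cone of a chain map. -/
def cone {F G : PosetComplex k P} (φ : Hom F G) : PosetComplex k P where
  ι i := F.shift.ι i ⊕ G.ι i
  fintype i := inferInstance
  deg i := Sum.elim (F.shift.deg i) (G.deg i)
  d i := Matrix.fromBlocks (F.shift.d i) 0 (φ.f i) (G.d i)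
  triangular i := by
    rintro (p | p) (q | q) h
    · exact F.shift.triangular i p q h
    · exact absurd rfl h
    · exact φ.triangular i p q h
    · exact G.triangular i p q h
  d_mul_d i := by
    have h : φ.f i * -F.d i + G.d i * φ.f (i + 1) = 0 := by
      rw [φ.comm, Matrix.mul_neg, neg_add_cancel]
    refine (Matrix.fromBlocks_multiply _ _ _ _ _ _ _ _).trans ?_
    refine fromBlocks_eq_zero ?_ ?_ h ?_
    · exact (congrArg₂ (fun X Y : Matrix (F.shift.ι i) (F.ι (i + 1)) k => X + Y)
        (F.shift.d_mul_d i) (Matrix.zero_mul _)).trans (add_zero _)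
    · exact (congrArg₂ (· + ·) (Matrix.mul_zero _) (Matrix.zero_mul _)).trans (add_zero _)
    · exact (congrArg₂ (· + ·) (Matrix.mul_zero _) (G.d_mul_d i)).trans (add_zero _)

variable {F G : PosetComplex k P} {S S' : Set P} {ε : F.ι 0 → k} {η : G.ι 0 → k}

/-- The chain map joins generators of F and G of the same homological index. If these never share a
degree, its degree a blocks are empty or zero, the strands of the cone are block diagonal, and ranks
add. -/
theorem betti_cone (φ : Hom F G) (h : ∀ i p q, G.deg i p ≠ F.deg i q) (i : ℕ) (a : P) :
    (cone φ).betti i a = F.shift.betti i a + G.betti i a := by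
  classical
  let e : ∀ i, {p // (cone φ).deg i p = a} ≃
      {p // F.shift.deg i p = a} ⊕ {p // G.deg i p = a} := fun i => Equiv.subtypeSum
  have hr : ∀ i, ((cone φ).strand i a).rank = (F.shift.strand i a).rank +
      (G.strand i a).rank := by
    intro i
    rw [← rank_fromBlocks_diagonal, ← Matrix.rank_submatrix _ (e i) (e (i + 1))]
    congr 1
    ext ⟨p | p, hp⟩ ⟨q | q, hq⟩
    · rfl
    · rfl
    · exact absurd (hp.trans hq.symm) (h i p q)
    · rfl
  have hc : ∀ i, Fintype.card {p // (cone φ).deg i p = a} =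
      Fintype.card {p // F.shift.deg i p = a} + Fintype.card {p // G.deg i p = a} := fun i => by
    rw [Fintype.card_congr (e i), Fintype.card_sum]
  cases i with
  | zero =>
    have h1 := F.shift.betti_add_rank_zero a
    have h2 := G.betti_add_rank_zero a
    have h3 := (cone φ).betti_add_rank_zero a
    rw [hr, hc] at h3
    omega
  | succ i =>
    have h1 := F.shift.betti_add_rank_succ i a
    have h2 := G.betti_add_rank_succ i a
    have h3 := (cone φ).betti_add_rank_succ i a
    rw [hr, hr, hc] at h3
    omega

/-- The elements of degree `0` of a mapping cone. -/
def coneZero (φ : Hom F G) (z : G.ι 0 → k) : (cone φ).ι 0 → k :=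
  Sum.elim (fun p => p.elim) z

/-- The elements of positive degree of a mapping cone. -/
def coneSucc (φ : Hom F G) (i : ℕ) (y : F.ι i → k) (z : G.ι (i + 1) → k) :
    (cone φ).ι (i + 1) → k :=
  Sum.elim y z

section coneElements

variable (φ : Hom F G)

theorem exists_eq_coneZero (x : (cone φ).ι 0 → k) : ∃ z, x = coneZero φ z :=
  ⟨x ∘ Sum.inr, funext fun p => p.casesOn (fun p => p.elim) fun _ => rfl⟩

theorem exists_eq_coneSucc {i : ℕ} (x : (cone φ).ι (i + 1) → k) :
    ∃ y z, x = coneSucc φ i y z :=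
  ⟨x ∘ Sum.inl, x ∘ Sum.inr, (Sum.elim_comp_inl_inr x).symm⟩

theorem coneSucc_eq_zero {i : ℕ} {y : F.ι i → k} {z : G.ι (i + 1) → k}
    (h : coneSucc φ i y z = 0) : y = 0 ∧ z = 0 :=
  ⟨funext fun p => congrFun h (Sum.inl p), funext fun p => congrFun h (Sum.inr p)⟩

theorem coneZero_mem_below {a : P} {z : G.ι 0 → k} :
    coneZero φ z ∈ below k ((cone φ).deg 0) a ↔ z ∈ below k (G.deg 0) a :=
  Sum.forall.trans (and_iff_right fun p => p.elim)

theorem coneSucc_mem_below {i : ℕ} {a : P} {y : F.ι i → k} {z : G.ι (i + 1) → k} :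
    coneSucc φ i y z ∈ below k ((cone φ).deg (i + 1)) a ↔
      y ∈ below k (F.deg i) a ∧ z ∈ below k (G.deg (i + 1)) a :=
  Sum.forall

theorem cone_d_zero_mulVec (y : F.ι 0 → k) (z : G.ι 1 → k) :
    (cone φ).d 0 *ᵥ coneSucc φ 0 y z = coneZero φ (φ.f 0 *ᵥ y + G.d 0 *ᵥ z) := by
  refine (Matrix.fromBlocks_mulVec _ _ _ _ _).trans (funext ?_)
  rintro (p | p)
  · exact p.elim
  · rfl

theorem cone_d_succ_mulVec (i : ℕ) (y : F.ι (i + 1) → k) (z : G.ι (i + 2) → k) :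
    (cone φ).d (i + 1) *ᵥ coneSucc φ (i + 1) y z =
      coneSucc φ i (-(F.d i *ᵥ y)) (φ.f (i + 1) *ᵥ y + G.d (i + 1) *ᵥ z) := by
  refine (Matrix.fromBlocks_mulVec _ _ _ _ _).trans ?_
  rw [Matrix.zero_mulVec, add_zero]
  exact congrArg₂ Sum.elim (Matrix.neg_mulVec _ _) rfl

/-- The augmentation of a mapping cone. -/
def coneAug (η : G.ι 0 → k) : (cone φ).ι 0 → k := Sum.elim (fun p => p.elim) η

theorem coneAug_dotProduct (η z : G.ι 0 → k) : coneAug φ η ⬝ᵥ coneZero φ z = η ⬝ᵥ z :=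
  (Fintype.sum_sum_type _).trans
    ((congrArg (· + _) (Finset.sum_eq_zero fun p _ => p.elim)).trans (zero_add _))

end coneElements

open scoped Classical in
/-- The mapping cone of a lift of an inclusion is a resolution of the quotient. -/
theorem Resolves.cone (hF : F.Resolves S ε) (hG : G.Resolves S' η) (hS : S ⊆ S')
    (hup : ∀ a ∈ S, ∀ b ∈ S', a ≤ b → b ∈ S) (φ : Hom F G) (hφ : η ᵥ* φ.f 0 = ε) :
    (cone φ).Resolves (S' \ S) (coneAug φ fun p => if G.deg 0 p ∈ S then 0 else η p) := by
  -- The augmentation of the cone must vanish on generators with degree in S, which η need not do.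
  -- Such generators lie below no degree of S' \ S, so the truncation is invisible there.
  have hη : ∀ a ∈ S' \ S, ∀ z ∈ below k (G.deg 0) a,
      (fun p => if G.deg 0 p ∈ S then 0 else η p) ⬝ᵥ z = η ⬝ᵥ z := by
    intro a ha z hz
    refine Finset.sum_congr rfl fun p _ => ?_
    by_cases hp : z p = 0
    · rw [hp, mul_zero, mul_zero]
    · exact congrArg (· * z p) (if_neg fun h => ha.2 (hup _ h _ ha.1 (hz p hp)))
  have hε : ∀ a ∈ S' \ S, ∀ y ∈ below k (F.deg 0) a, ε ⬝ᵥ y = 0 := by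
    intro a ha y hy
    refine Finset.sum_eq_zero fun p _ => ?_
    by_contra h
    refine ha.2 (hup (F.deg 0 p) ?_ a ha.1 (hy p (right_ne_zero_of_mul h)))
    exact by_contra fun hp => left_ne_zero_of_mul h (hF.eps_eq_zero p hp)
  have hεφ : ∀ y, ε ⬝ᵥ y = η ⬝ᵥ φ.f 0 *ᵥ y := fun y => by rw [Matrix.dotProduct_mulVec, hφ]
  refine ⟨?_, ?_, ?_, ?_, ?_⟩
  · rintro (p | p) hp
    · exact p.elim
    · change (if _ then _ else _) = _
      split_ifs with h
      · rfl
      · exact hG.eps_eq_zero p fun h' => hp ⟨h', h⟩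
  · intro a ha
    obtain ⟨x, hx, h1⟩ := hG.exists_eps_eq_one a ha.1
    exact ⟨coneZero φ x, (coneZero_mem_below φ).2 hx, by rw [coneAug_dotProduct, hη a ha x hx, h1]⟩
  · intro a ha x hx
    obtain ⟨y, z, rfl⟩ := exists_eq_coneSucc φ x
    obtain ⟨hy, hz⟩ := (coneSucc_mem_below φ).1 hx
    rw [cone_d_zero_mulVec, coneAug_dotProduct, hη a ha _ (Submodule.add_mem _
      ((φ.triangular 0).mulVec_mem hy) ((G.triangular 0).mulVec_mem hz)), dotProduct_add, ← hεφ,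
      hε a ha y hy, hG.eps_d a ha.1 z hz, add_zero]
  · intro a x hx hx'
    obtain ⟨z, rfl⟩ := exists_eq_coneZero φ x
    rw [coneZero_mem_below] at hx
    rw [coneAug_dotProduct] at hx'
    -- For a ∈ S the submodule is the whole degree a part, so the value of z under η can be
    -- cancelled by an element coming from F; for a ∈ S' \ S it vanishes already.
    have key : ∃ w ∈ below k (F.deg 0) a, a ∈ S' → η ⬝ᵥ (z - φ.f 0 *ᵥ w) = 0 := by
      by_cases ha : a ∈ S
      · obtain ⟨w, hw, hw1⟩ := hF.exists_eps_eq_one a ha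
        refine ⟨(η ⬝ᵥ z) • w, Submodule.smul_mem _ _ hw, fun _ => ?_⟩
        rw [dotProduct_sub, ← hεφ, dotProduct_smul, hw1, smul_eq_mul, mul_one, sub_self]
      · refine ⟨0, Submodule.zero_mem _, fun ha' => ?_⟩
        rw [Matrix.mulVec_zero, sub_zero, ← hη a ⟨ha', ha⟩ z hx, hx' ⟨ha', ha⟩]
    obtain ⟨w, hw, hw'⟩ := key
    obtain ⟨t, ht, ht'⟩ := hG.exact_zero a _
      (Submodule.sub_mem _ hx ((φ.triangular 0).mulVec_mem hw)) hw'
    refine ⟨coneSucc φ 0 w t, (coneSucc_mem_below φ).2 ⟨hw, ht⟩, ?_⟩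
    rw [cone_d_zero_mulVec, ht', add_sub_cancel]
  · intro i a x hx hx'
    obtain ⟨y, z, rfl⟩ := exists_eq_coneSucc φ x
    obtain ⟨hy, hz⟩ := (coneSucc_mem_below φ).1 hx
    have key : (∃ w ∈ below k (F.deg (i + 1)) a, F.d i *ᵥ w = y) ∧
        φ.f i *ᵥ y + G.d i *ᵥ z = 0 := by
      cases i with
      | zero =>
        rw [cone_d_zero_mulVec] at hx'
        have h2 : φ.f 0 *ᵥ y + G.d 0 *ᵥ z = 0 := funext fun p => congrFun hx' (Sum.inr p)
        refine ⟨hF.exact_zero a y hy fun ha => ?_, h2⟩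
        -- At the bottom of the cone there is no equation saying that y is a cycle. Instead ε y =
        -- η(φy) = −η(∂z) = 0, and exactness at F₀ applies.
        rw [hεφ, eq_neg_of_add_eq_zero_left h2, dotProduct_neg, hG.eps_d a (hS ha) z hz, neg_zero]
      | succ i =>
        rw [cone_d_succ_mulVec] at hx'
        obtain ⟨h1, h2⟩ := coneSucc_eq_zero φ hx'
        exact ⟨hF.exact_succ i a y hy (neg_eq_zero.1 h1), h2⟩
    obtain ⟨⟨w, hw, rfl⟩, h2⟩ := key
    obtain ⟨t, ht, ht'⟩ := hG.exact_succ i a (z + φ.f (i + 1) *ᵥ w)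
      (Submodule.add_mem _ hz ((φ.triangular _).mulVec_mem hw)) (by
        rw [Matrix.mulVec_add, Matrix.mulVec_mulVec, φ.comm, ← Matrix.mulVec_mulVec, add_comm, h2])
    refine ⟨coneSucc φ (i + 1) (-w) t,
      (coneSucc_mem_below φ).2 ⟨Submodule.neg_mem _ hw, ht⟩, ?_⟩
    rw [cone_d_succ_mulVec, ht', Matrix.mulVec_neg, Matrix.mulVec_neg, neg_neg,
      neg_add_eq_sub, add_sub_cancel_right]

end PosetComplex

/-! ### From graded resolutions over the polynomial ring to scalar complexes -/

section Bridge

open MvPolynomial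

variable {k : Type*} [Field k] {V : Type*}

/-- The exponents of the monomials that are divisible by no edge of `G`. -/
def edgeFree (G : SimpleGraph V) : Set (V →₀ ℕ) :=
  {a | ∀ x y, G.Adj x y → a x = 0 ∨ a y = 0}

theorem edgeFree_of_le {G : SimpleGraph V} {a b : V →₀ ℕ} (hb : b ∈ edgeFree G) (h : a ≤ b) :
    a ∈ edgeFree G := fun x y hxy =>
  (hb x y hxy).imp (fun h0 => Nat.le_zero.1 ((h x).trans h0.le))
    fun h0 => Nat.le_zero.1 ((h y).trans h0.le)

theorem single_add_single_le_iff [DecidableEq V] {x y : V} (h : x ≠ y) (m : V →₀ ℕ) :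
    Finsupp.single x 1 + Finsupp.single y 1 ≤ m ↔ m x ≠ 0 ∧ m y ≠ 0 := by
  constructor
  · intro hm
    have hx := hm x
    have hy := hm y
    rw [Finsupp.add_apply, Finsupp.single_eq_same] at hx hy
    omega
  · rintro ⟨hx, hy⟩ z
    rw [Finsupp.add_apply, Finsupp.single_apply, Finsupp.single_apply]
    split_ifs with h1 h2 h2
    · exact absurd (h1.trans h2.symm) h
    · subst h1; omega
    · subst h2; omega
    · omega

/-- The ideal is monomial, so membership is decided on the support: each monomial must be divisible
by some xy with {x, y} an edge. -/
theorem mem_graphIdeal_iff (G : SimpleGraph V) (f : MvPolynomial V k) :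
    f ∈ graphIdeal k G ↔ ∀ m ∈ f.support, m ∉ edgeFree G := by
  classical
  have hI : graphIdeal k G = Ideal.span ((fun s => monomial s (1 : k)) ''
      {s | ∃ x y : V, G.Adj x y ∧ s = Finsupp.single x 1 + Finsupp.single y 1}) := by
    unfold graphIdeal
    congr 1
    ext g
    constructor
    · rintro ⟨x, y, h, rfl⟩
      exact ⟨_, ⟨x, y, h, rfl⟩, by simp [X, monomial_mul]⟩
    · rintro ⟨_, ⟨x, y, h, rfl⟩, rfl⟩
      exact ⟨x, y, h, by simp [X, monomial_mul]⟩
  rw [hI, mem_ideal_span_monomial_image]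
  refine forall₂_congr fun m _ => ?_
  simp only [edgeFree, Set.mem_ofPred_eq, not_forall, not_or]
  constructor
  · rintro ⟨_, ⟨x, y, h, rfl⟩, hm⟩
    exact ⟨x, y, h, (single_add_single_le_iff h.ne m).1 hm⟩
  · rintro ⟨x, y, h, hm⟩
    exact ⟨_, ⟨x, y, h, rfl⟩, (single_add_single_le_iff h.ne m).2 hm⟩

theorem mk_monomial_eq_zero_iff (G : SimpleGraph V) (a : V →₀ ℕ) (c : k) :
    Ideal.Quotient.mk (graphIdeal k G) (monomial a c) = 0 ↔ (a ∈ edgeFree G → c = 0) := by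
  classical
  rw [Ideal.Quotient.eq_zero_iff_mem, mem_graphIdeal_iff]
  by_cases hc : c = 0
  · simp [hc]
  · simp [support_monomial, hc]

section Homogeneous

variable {l m : Type*} {e : l → V →₀ ℕ} {f : m → V →₀ ℕ}

/-- The element of degree `a` of a graded free module with the given scalar coordinates. -/
noncomputable def homogenize (f : m → V →₀ ℕ) (a : V →₀ ℕ) (x : m → k) : m → MvPolynomial V k :=
  fun p => monomial (a - f p) (x p)

theorem homogenize_injective (f : m → V →₀ ℕ) (a : V →₀ ℕ) :
    Function.Injective (homogenize (k := k) f a) := by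
  classical
  intro x y h
  funext p
  simpa [homogenize, coeff_monomial] using congrArg (coeff (a - f p)) (congrFun h p)

theorem homogenize_zero (f : m → V →₀ ℕ) (a : V →₀ ℕ) : homogenize f a (0 : m → k) = 0 :=
  funext fun _ => monomial_zero

/-- The matrix obtained from a homogeneous matrix by setting all variables equal to one. -/
noncomputable def dehomogenize (e : l → V →₀ ℕ) (f : m → V →₀ ℕ)
    (D : Matrix l m (MvPolynomial V k)) : Matrix l m k :=
  Matrix.of fun p q => coeff (f q - e p) (D p q)

variable {D : Matrix l m (MvPolynomial V k)}

theorem triangular_dehomogenize (hD : ∀ p q, ∀ t ∈ (D p q).support, e p + t = f q) :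
    Triangular e f (dehomogenize e f D) := by
  intro p q h
  rw [← hD p q _ (mem_support_iff.2 h)]
  exact le_self_add

theorem eq_monomial_dehomogenize (hD : ∀ p q, ∀ t ∈ (D p q).support, e p + t = f q) (p : l)
    (q : m) : D p q = monomial (f q - e p) (dehomogenize e f D p q) := by
  classical
  ext t
  rw [coeff_monomial]
  split_ifs with h
  · rw [← h]
    rfl
  · rw [← notMem_support_iff]
    intro ht
    exact h (by rw [← hD p q t ht, add_tsub_cancel_left])

theorem mulVec_homogenize [Fintype m] (hD : ∀ p q, ∀ t ∈ (D p q).support, e p + t = f q)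
    {a : V →₀ ℕ} {x : m → k} (hx : x ∈ below k f a) :
    D *ᵥ homogenize f a x = homogenize e a (dehomogenize e f D *ᵥ x) := by
  funext p
  simp only [homogenize, Matrix.mulVec, dotProduct, map_sum]
  refine Finset.sum_congr rfl fun q _ => ?_
  rw [eq_monomial_dehomogenize hD, monomial_mul]
  by_cases h : dehomogenize e f D p q * x q = 0
  · rw [h, monomial_zero, monomial_zero]
  · congr 1
    rw [add_comm, tsub_add_tsub_cancel (hx q (right_ne_zero_of_mul h))
      (triangular_dehomogenize hD p q (left_ne_zero_of_mul h))]

open scoped Classical in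
/-- The scalar coordinates of the component in degree `a` of an element. -/
noncomputable def coords (f : m → V →₀ ℕ) (a : V →₀ ℕ) (y : m → MvPolynomial V k) : m → k :=
  fun p => if f p ≤ a then coeff (a - f p) (y p) else 0

theorem coords_mem_below (f : m → V →₀ ℕ) (a : V →₀ ℕ) (y : m → MvPolynomial V k) :
    coords f a y ∈ below k f a := by
  intro p hp
  by_contra h
  exact hp (if_neg h)

theorem homogenize_coords (f : m → V →₀ ℕ) (a : V →₀ ℕ) (y : m → MvPolynomial V k) (p : m) :
    homogenize f a (coords f a y) p = shiftComp (f p) a (y p) := by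
  simp only [homogenize, coords, shiftComp]
  split_ifs <;> simp

theorem shiftComp_homogenize {a : V →₀ ℕ} {x : m → k} (hx : x ∈ below k f a) (p : m) :
    shiftComp (f p) a (homogenize f a x p) = homogenize f a x p := by
  classical
  simp only [homogenize, shiftComp]
  split_ifs with h
  · rw [coeff_monomial, if_pos rfl]
  · rw [by_contra fun hp => h (hx p hp), monomial_zero]

/-- A homogeneous system that is solvable over the polynomial ring has a homogeneous solution,
namely the degree a component of any solution. This transfers exactness to the scalar matrices. -/
theorem exists_dehomogenize_mulVec_eq [Fintype m]
    (hD : ∀ p q, ∀ t ∈ (D p q).support, e p + t = f q) {a : V →₀ ℕ} {x : l → k}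
    (hx : x ∈ below k e a) (h : ∃ y, D *ᵥ y = homogenize e a x) :
    ∃ y ∈ below k f a, dehomogenize e f D *ᵥ y = x := by
  obtain ⟨y, hy⟩ := h
  refine ⟨coords f a y, coords_mem_below f a y, homogenize_injective e a ?_⟩
  rw [← mulVec_homogenize hD (coords_mem_below f a y)]
  funext p
  rw [← shiftComp_homogenize hx, ← hy]
  simp only [Matrix.mulVec, dotProduct]
  rw [shiftComp_sum]
  refine Finset.sum_congr rfl fun q _ => ?_
  rw [homogenize_coords, shiftComp_mul _ _ _ _ _ (hD p q)]

end Homogeneous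

namespace GradedFreeResolution

variable {G : SimpleGraph V}

/-- The complex of scalar matrices that is obtained from a graded free resolution by setting all
variables equal to one. -/
noncomputable def toPosetComplex {I : Ideal (MvPolynomial V k)} (F : GradedFreeResolution I) :
    PosetComplex k (V →₀ ℕ) where
  ι i := Fin (F.rank i)
  deg := F.deg
  d i := dehomogenize (F.deg i) (F.deg (i + 1)) (F.d i)
  triangular i := triangular_dehomogenize (F.homogeneous_d i)
  d_mul_d i := by
    ext p q
    refine congrFun (?_ : (dehomogenize (F.deg i) (F.deg (i + 1)) (F.d i) *
      dehomogenize (F.deg (i + 1)) (F.deg (i + 2)) (F.d (i + 1))).col q = 0) p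
    refine homogenize_injective (F.deg i) (F.deg (i + 2) q) ?_
    have hq := single_mem_below (F.deg (i + 2)) q (1 : k)
    rw [← Matrix.mulVec_single_one, ← Matrix.mulVec_mulVec,
      ← mulVec_homogenize (F.homogeneous_d i)
        ((triangular_dehomogenize (F.homogeneous_d (i + 1))).mulVec_mem hq),
      ← mulVec_homogenize (F.homogeneous_d (i + 1)) hq, homogenize_zero]
    exact (F.exact_succ i _).2 ⟨_, rfl⟩

/-- The scalars that describe the augmentation. -/
noncomputable def augCoeff {I : Ideal (MvPolynomial V k)} (F : GradedFreeResolution I)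
    (p : Fin (F.rank 0)) : k :=
  (F.homogeneous_aug p).choose

theorem aug_eq {I : Ideal (MvPolynomial V k)} (F : GradedFreeResolution I)
    (y : Fin (F.rank 0) → MvPolynomial V k) :
    F.aug y = Ideal.Quotient.mk I (∑ p, y p * monomial (F.deg 0 p) (F.augCoeff p)) := by
  rw [LinearMap.pi_apply_eq_sum_univ F.aug y, map_sum]
  refine Finset.sum_congr rfl fun p _ => ?_
  have h : (fun j => if p = j then (1 : MvPolynomial V k) else 0) = Pi.single p 1 := by
    funext j
    rw [Pi.single_apply]
    simp only [eq_comm]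
  rw [h, (F.homogeneous_aug p).choose_spec, map_mul, ← smul_eq_mul]
  rfl

theorem aug_homogenize {I : Ideal (MvPolynomial V k)} (F : GradedFreeResolution I) {a : V →₀ ℕ}
    {x : Fin (F.rank 0) → k} (hx : x ∈ below k (F.deg 0) a) :
    F.aug (homogenize (F.deg 0) a x) = Ideal.Quotient.mk I (monomial a (F.augCoeff ⬝ᵥ x)) := by
  rw [aug_eq, dotProduct, map_sum (monomial a)]
  congr 1
  refine Finset.sum_congr rfl fun p _ => ?_
  rw [homogenize, monomial_mul, mul_comm]
  by_cases h : x p = 0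
  · rw [h, mul_zero, monomial_zero, monomial_zero]
  · rw [tsub_add_cancel_of_le (hx p h)]

-- The degree a strand of the resolution is the scalar complex on generators of degree ≤ a, and the
-- quotient ring is spanned in degree a by a monomial that is nonzero exactly when a is edge-free.
-- The scalars `augCoeff` are arbitrary where that monomial is zero, hence the truncation.
open scoped Classical in
theorem resolves (F : GradedFreeResolution (graphIdeal k G)) :
    F.toPosetComplex.Resolves (edgeFree G)
      fun p : Fin (F.rank 0) => if F.deg 0 p ∈ edgeFree G then F.augCoeff p else 0 := by
  have hε : ∀ a ∈ edgeFree G, ∀ x ∈ below k (F.deg 0) a,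
      (fun p => if F.deg 0 p ∈ edgeFree G then F.augCoeff p else 0) ⬝ᵥ x = F.augCoeff ⬝ᵥ x := by
    intro a ha x hx
    refine Finset.sum_congr rfl fun p _ => ?_
    by_cases h : x p = 0
    · rw [h, mul_zero, mul_zero]
    · exact congrArg (· * x p) (if_pos (edgeFree_of_le ha (hx p h)))
  refine ⟨fun p hp => if_neg hp, ?_, ?_, ?_, ?_⟩
  · intro a ha
    obtain ⟨y, hy⟩ := F.aug_surjective (Ideal.Quotient.mk _ (monomial a 1))
    refine ⟨coords (F.deg 0) a y, coords_mem_below _ a y, ?_⟩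
    refine (hε a ha _ (coords_mem_below _ a y)).trans ?_
    rw [aug_eq, Ideal.Quotient.eq, mem_graphIdeal_iff] at hy
    have h := notMem_support_iff.1 fun h => hy a h ha
    rw [coeff_sub, coeff_monomial, if_pos rfl, sub_eq_zero, coeff_sum] at h
    rw [← h]
    refine Finset.sum_congr rfl fun p _ => ?_
    rw [coeff_mul_monomial', coords, mul_ite, mul_zero, mul_comm]
  · intro a ha y hy
    refine (hε a ha _ (F.toPosetComplex.triangular 0 |>.mulVec_mem hy)).trans ?_
    refine (mk_monomial_eq_zero_iff G a _).1 ?_ ha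
    refine (F.aug_homogenize (F.toPosetComplex.triangular 0 |>.mulVec_mem hy)).symm.trans ?_
    refine (congrArg F.aug (mulVec_homogenize (F.homogeneous_d 0) hy).symm).trans ?_
    exact (F.exact_zero _).2 ⟨_, rfl⟩
  · intro a x hx hx'
    refine exists_dehomogenize_mulVec_eq (F.homogeneous_d 0) hx ((F.exact_zero _).1 ?_)
    rw [aug_homogenize F hx, mk_monomial_eq_zero_iff]
    exact fun ha => (hε a ha x hx).symm.trans (hx' ha)
  · intro i a x hx hx'
    refine exists_dehomogenize_mulVec_eq (F.homogeneous_d (i + 1)) hx ((F.exact_succ i _).1 ?_)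
    refine (mulVec_homogenize (F.homogeneous_d i) hx).trans ?_
    exact (congrArg _ hx').trans (homogenize_zero _ _)

theorem betti_toPosetComplex {I : Ideal (MvPolynomial V k)} (F : GradedFreeResolution I) (i : ℕ)
    (a : V →₀ ℕ) : F.toPosetComplex.betti i a = Module.finrank k (F.Tor i a) := by
  classical
  -- Between generators of equal degree the exponent in `dehomogenize` is 0, so the scalar entry is
  -- the constant coefficient.
  have hs : ∀ i, F.toPosetComplex.strand i a = F.strand i a := by
    intro i
    ext ⟨p, hp⟩ ⟨q, hq⟩
    change coeff (F.deg (i + 1) q - F.deg i p) (F.d i p q) = constantCoeff (F.d i p q)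
    have hp' : F.deg i p = a := hp
    have hq' : F.deg (i + 1) q = a := hq
    rw [hp', hq', tsub_self]
    rfl
  have hM : ∀ {m n : Type} (h₁ h₂ : Fintype n) {M N : Matrix m n k}, M = N →
      @Matrix.mulVecLin _ _ _ _ h₁ M = @Matrix.mulVecLin _ _ _ _ h₂ N := by
    rintro m n h₁ h₂ M _ rfl
    rw [Subsingleton.elim h₁ h₂]
  have hc : ∀ i, F.toPosetComplex.cycles a i = F.torCycles a i := by
    rintro (_ | i)
    · rfl
    · exact congrArg LinearMap.ker (hM _ _ (hs i))
  have hb : ∀ i, F.toPosetComplex.boundaries a i = F.torBoundaries a i := fun i =>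
    congrArg LinearMap.range (hM _ _ (hs i))
  exact congrArg₂ (fun Z B : Submodule k ({p : Fin (F.rank i) // F.deg i p = a} → k) =>
    Module.finrank k (Z ⧸ B.submoduleOf Z)) (hc i) (hb i)

end GradedFreeResolution

end Bridge

/-! ### Total Betti numbers, translation of degrees and extra variables -/

namespace PosetComplex

variable {k : Type*} [Field k]

section bettiInt

variable {P : Type*} [PartialOrder P]

/-- The numbers `betti i a`, extended by zero to the negative integers `i`. -/
noncomputable def bettiInt (F : PosetComplex k P) : ℤ → P → ℕ
  | Int.ofNat i, a => F.betti i a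
  | Int.negSucc _, _ => 0

theorem bettiInt_eq_zero (F : PosetComplex k P) {i : ℤ} {a : P}
    (h : ∀ j p, F.deg j p ≠ a) : F.bettiInt i a = 0 := by
  cases i with
  | ofNat i => exact F.betti_eq_zero (h i)
  | negSucc i => rfl

theorem finite_support_bettiInt (F : PosetComplex k P) (i : ℤ) :
    (Function.support (F.bettiInt i)).Finite := by
  cases i with
  | ofNat i =>
    refine (Set.finite_range (F.deg i)).subset fun a ha => ?_
    by_contra h
    exact ha (F.betti_eq_zero fun p hp => h ⟨p, hp⟩)
  | negSucc i => exact Set.finite_empty.subset fun a ha => ha rfl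

theorem bettiInt_cone {F G : PosetComplex k P} (φ : Hom F G)
    (h : ∀ i p q, G.deg i p ≠ F.deg i q) (i : ℤ) (a : P) :
    (cone φ).bettiInt i a = F.bettiInt (i - 1) a + G.bettiInt i a := by
  rcases i with (_ | i) | i
  · exact (betti_cone φ h 0 a).trans (congrArg (· + _) (F.betti_shift_zero a))
  · have hi : Int.ofNat (i + 1) - 1 = Int.ofNat i := by simp
    rw [hi]
    exact (betti_cone φ h (i + 1) a).trans (congrArg (· + _) (F.betti_shift_succ i a))
  · have hi : Int.negSucc i - 1 = Int.negSucc (i + 1) := by simp only [Int.negSucc_eq]; omega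
    rw [hi]
    rfl

theorem bettiInt_mapDeg (F : PosetComplex k P) {Q : Type*} [PartialOrder Q] {s : P → Q}
    (hs : Monotone s) (hinj : Function.Injective s) (i : ℤ) (a : P) :
    (F.mapDeg s hs).bettiInt i (s a) = F.bettiInt i a := by
  cases i with
  | ofNat i => exact F.betti_mapDeg hs hinj i a
  | negSucc i => rfl

end bettiInt

section total

variable {V W : Type*}

/-- The sum of the numbers `bettiInt i a` over all `a` of total degree `d`. -/
noncomputable def total (F : PosetComplex k (V →₀ ℕ)) (i d : ℤ) : ℕ :=
  ∑ᶠ (a : V →₀ ℕ) (_ : a ∈ {a : V →₀ ℕ | (a.degree : ℤ) = d}), F.bettiInt i a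

theorem total_cone {F G : PosetComplex k (V →₀ ℕ)} (φ : Hom F G)
    (h : ∀ i p q, G.deg i p ≠ F.deg i q) (i d : ℤ) :
    (cone φ).total i d = F.total (i - 1) d + G.total i d := by
  rw [total, total, total, ← finsum_mem_add_distrib'
    ((F.finite_support_bettiInt _).inter_of_right _)
    ((G.finite_support_bettiInt _).inter_of_right _)]
  exact finsum_mem_congr rfl fun a _ => bettiInt_cone φ h i a

theorem total_mapDeg (F : PosetComplex k (V →₀ ℕ)) {s : (V →₀ ℕ) → (W →₀ ℕ)} (hs : Monotone s)
    (hinj : Function.Injective s) {c : ℤ} (hc : ∀ a, ((s a).degree : ℤ) = a.degree + c)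
    (i d : ℤ) : (F.mapDeg s hs).total i d = F.total i (d - c) := by
  have h : F.total i (d - c) =
      ∑ᶠ a ∈ s '' {a : V →₀ ℕ | (a.degree : ℤ) = d - c}, (F.mapDeg s hs).bettiInt i a := by
    rw [finsum_mem_image hinj.injOn]
    exact finsum_mem_congr rfl fun a _ => (F.bettiInt_mapDeg hs hinj i a).symm
  rw [h, total]
  refine finsum_mem_inter_support_eq' _ _ _ fun a ha => ?_
  -- Degrees outside the image of s carry no generators and contribute nothing to the sum.
  obtain ⟨b, rfl⟩ : ∃ b, s b = a := by
    by_contra hb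
    exact ha (bettiInt_eq_zero _ fun j p hp => hb ⟨_, hp⟩)
  rw [hinj.mem_set_image, Set.mem_ofPred_eq, Set.mem_ofPred_eq, hc]
  omega

end total

section Translate

variable {V : Type*} (F : PosetComplex k (V →₀ ℕ)) (δ : V →₀ ℕ)

/-- The complex with all degrees increased by `δ`. -/
noncomputable def translate : PosetComplex k (V →₀ ℕ) :=
  F.mapDeg (· + δ) fun _ _ h => add_le_add_left h δ

theorem total_translate (i d : ℤ) :
    (F.translate δ).total i d = F.total i (d - (δ.degree : ℤ)) :=
  F.total_mapDeg _ (add_left_injective δ) (fun a => by rw [map_add, Nat.cast_add]) i d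

variable {F} {S : Set (V →₀ ℕ)} {ε : F.ι 0 → k}

theorem Resolves.translate (hF : F.Resolves S ε) :
    (F.translate δ).Resolves {a | δ ≤ a ∧ a - δ ∈ S} ε := by
  refine hF.mapDeg _ (fun b hb => ⟨le_add_self, by rwa [add_tsub_cancel_right]⟩) fun a => ?_
  by_cases h : δ ≤ a
  · exact Or.inl ⟨a - δ, fun b => (le_tsub_iff_right h).symm, and_iff_right h⟩
  · exact Or.inr ⟨fun b hb => h (le_add_self.trans hb), fun ha => h ha.1⟩

end Translate

section Extend

variable {V : Type*} {s : Set V} (F : PosetComplex k (s →₀ ℕ))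

theorem mapDomain_val_apply (b : s →₀ ℕ) (x : s) :
    b.mapDomain Subtype.val (x : V) = b x :=
  Finsupp.mapDomain_apply Subtype.val_injective b x

theorem mapDomain_val_apply_of_notMem (b : s →₀ ℕ) {x : V} (hx : x ∉ s) :
    b.mapDomain Subtype.val x = 0 :=
  Finsupp.mapDomain_of_notMem_range _ _ fun ⟨y, hy⟩ => hx (hy ▸ y.2)

/-- Extension by zero is left adjoint to restriction; this is the condition needed by
`Resolves.mapDeg` to show that adjoining variables preserves resolutions. -/
theorem mapDomain_val_le_iff (b : s →₀ ℕ) (a : V →₀ ℕ) :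
    b.mapDomain Subtype.val ≤ a ↔ b ≤ a.subtypeDomain (· ∈ s) := by
  constructor
  · intro h x
    exact (mapDomain_val_apply b x).symm.le.trans (h x)
  · intro h x
    by_cases hx : x ∈ s
    · exact (mapDomain_val_apply b ⟨x, hx⟩).le.trans (h ⟨x, hx⟩)
    · rw [mapDomain_val_apply_of_notMem b hx]
      exact Nat.zero_le _

theorem monotone_mapDomain_val :
    Monotone (Finsupp.mapDomain Subtype.val : (s →₀ ℕ) → V →₀ ℕ) := fun a b h => by
  rw [mapDomain_val_le_iff]
  exact h.trans ((mapDomain_val_le_iff b _).1 le_rfl)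

/-- The extension of a complex to a larger set of variables. -/
noncomputable def extend : PosetComplex k (V →₀ ℕ) :=
  F.mapDeg (Finsupp.mapDomain Subtype.val) monotone_mapDomain_val

theorem total_extend (i d : ℤ) : F.extend.total i d = F.total i d := by
  rw [extend, F.total_mapDeg monotone_mapDomain_val
    (Finsupp.mapDomain_injective Subtype.val_injective) (c := 0)
    (fun a => by rw [Finsupp.degree_mapDomain, add_zero]), sub_zero]

theorem extend_deg_apply {i : ℕ} (p : F.ι i) {x : V} (hx : x ∉ s) : F.extend.deg i p x = 0 :=
  mapDomain_val_apply_of_notMem _ hx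

variable {F} {S : Set (s →₀ ℕ)} {ε : F.ι 0 → k}

theorem Resolves.extend (hF : F.Resolves S ε) :
    F.extend.Resolves {a | a.subtypeDomain (· ∈ s) ∈ S} ε := by
  refine hF.mapDeg _ (fun b hb => ?_) fun a => Or.inl ⟨_, fun b => mapDomain_val_le_iff b a, Iff.rfl⟩
  have : (b.mapDomain Subtype.val).subtypeDomain (· ∈ s) = b :=
    Finsupp.ext fun x => mapDomain_val_apply b x
  rw [Set.mem_ofPred_eq, this]
  exact hb

end Extend

theorem sum_choose_succ (f : ℕ → ℕ) (n : ℕ) :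
    ∑ j ∈ Finset.range (n + 2), (n + 1).choose j * f j =
      ∑ j ∈ Finset.range (n + 1), n.choose j * f (j + 1) +
        ∑ j ∈ Finset.range (n + 1), n.choose j * f j := by
  have h := Finset.sum_choose_succ_mul (fun j _ => f j) n
  simp only [Nat.cast_id] at h
  rw [h, add_comm]

theorem single_one_le_iff {V : Type*} {w : V} {a : V →₀ ℕ} :
    Finsupp.single w 1 ≤ a ↔ a w ≠ 0 := by
  rw [Finsupp.single_le_iff, Nat.one_le_iff_ne_zero]

/-! ### Killing variables that do not occur in a resolution -/

/-- A resolution that does not involve the variables in `W` yields a resolution of the residue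
class module modulo these variables. -/
theorem Resolves.exists_quotient {V : Type*} {G : PosetComplex k (V →₀ ℕ)} {S : Set (V →₀ ℕ)}
    {η : G.ι 0 → k} (hG : G.Resolves S η) (W : Finset V) (hdeg : ∀ w ∈ W, ∀ i p, G.deg i p w = 0)
    (hS : ∀ w ∈ W, ∀ a, a + Finsupp.single w 1 ∈ S ↔ a ∈ S) :
    ∃ (C : PosetComplex k (V →₀ ℕ)) (ε : C.ι 0 → k),
      C.Resolves {a | a ∈ S ∧ ∀ w ∈ W, a w = 0} ε ∧
      (∀ x ∉ W, (∀ i p, G.deg i p x = 0) → ∀ i p, C.deg i p x = 0) ∧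
      ∀ i d : ℤ, C.total i d =
        ∑ j ∈ Finset.range (W.card + 1), W.card.choose j * G.total (i - j) (d - j) := by
  classical
  induction W using Finset.induction_on with
  | empty =>
    refine ⟨G, η, by simpa using hG, fun x _ h => h, fun i d => by simp⟩
  | insert w W hw ih =>
    obtain ⟨C, ε, hC, hCdeg, hCtot⟩ := ih (fun x hx => hdeg x (Finset.mem_insert_of_mem hx))
      fun x hx => hS x (Finset.mem_insert_of_mem hx)
    have hCw : ∀ i p, C.deg i p w = 0 := hCdeg w hw (hdeg w (Finset.mem_insert_self w W))
    set S₁ : Set (V →₀ ℕ) := {a | a ∈ S ∧ ∀ w ∈ W, a w = 0} with hS₁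
    have hadd : ∀ a, a + Finsupp.single w 1 ∈ S₁ ↔ a ∈ S₁ := by
      intro a
      refine and_congr (hS w (Finset.mem_insert_self w W) a) (forall₂_congr fun x hx => ?_)
      rw [Finsupp.add_apply, Finsupp.single_eq_of_ne (ne_of_mem_of_not_mem hx hw), add_zero]
    have hD := hC.translate (Finsupp.single w 1)
    -- Membership in S₁ does not depend on the exponent of w, so multiplication by w is injective
    -- and its image consists of the degrees of S₁ where w occurs.
    have hS₂ : {a | Finsupp.single w 1 ≤ a ∧ a - Finsupp.single w 1 ∈ S₁} =
        {a | a ∈ S₁ ∧ a w ≠ 0} := by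
      ext a
      constructor
      · rintro ⟨h1, h2⟩
        rw [← hadd, tsub_add_cancel_of_le h1] at h2
        exact ⟨h2, single_one_le_iff.1 h1⟩
      · rintro ⟨h1, h2⟩
        have h3 := single_one_le_iff.2 h2
        refine ⟨h3, ?_⟩
        rwa [← hadd, tsub_add_cancel_of_le h3]
    rw [hS₂] at hD
    have hsub : {a | a ∈ S₁ ∧ a w ≠ 0} ⊆ S₁ := fun a ha => ha.1
    have hup : ∀ a ∈ {a | a ∈ S₁ ∧ a w ≠ 0}, ∀ b ∈ S₁, a ≤ b → b ∈ {a | a ∈ S₁ ∧ a w ≠ 0} :=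
      fun a ha b hb hab => ⟨hb, fun h => ha.2 (Nat.le_zero.1 ((hab w).trans h.le))⟩
    obtain ⟨φ, hφ⟩ := hD.exists_hom hC hsub hup
    -- The exponent of w is 0 on the generators of C and 1 on those of the translate, so nothing
    -- cancels in the cone.
    have hne : ∀ i p q, C.deg i p ≠ (C.translate (Finsupp.single w 1)).deg i q := by
      intro i p (q : C.ι i) h
      have h1 : C.deg i p w = C.deg i q w + Finsupp.single w 1 w := DFunLike.congr_fun h w
      rw [hCw, hCw, Finsupp.single_eq_same] at h1
      omega
    have hcone := hD.cone hC hsub hup φ hφ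
    have hset : S₁ \ {a | a ∈ S₁ ∧ a w ≠ 0} = {a | a ∈ S ∧ ∀ x ∈ insert w W, a x = 0} := by
      ext a
      simp only [hS₁, Set.mem_ofPred_eq, Set.mem_sdiff, Finset.forall_mem_insert]
      tauto
    rw [hset] at hcone
    refine ⟨PosetComplex.cone φ, _, hcone, ?_, ?_⟩
    · intro x hx hGx
      rw [Finset.mem_insert, not_or] at hx
      have hCx := hCdeg x hx.2 hGx
      rintro (_ | i) (p | p)
      · exact p.elim
      · exact hCx 0 p
      · exact congrArg₂ (· + ·) (hCx i p) (Finsupp.single_eq_of_ne hx.1)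
      · exact hCx (i + 1) p
    · intro i d
      -- The cone adds the copy shifted by (1, 1) to the unshifted one, which is Pascal's rule for
      -- the binomial coefficients.
      rw [total_cone φ hne, total_translate, hCtot, hCtot, Finset.card_insert_of_notMem hw,
        sum_choose_succ (fun j => G.total (i - j) (d - j))]
      congr 1
      refine Finset.sum_congr rfl fun j _ => ?_
      rw [Finsupp.degree_single]
      push_cast
      rw [sub_sub, sub_sub, add_comm (1 : ℤ)]

end PosetComplex

/-! ### The recursion at a leaf -/

open PosetComplex

/-- The graded Betti numbers of a graph can be computed from any resolution. -/
theorem betti_eq_total {k : Type*} [Field k] {V : Type*} [Finite V] (G : SimpleGraph V)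
    {F : PosetComplex k (V →₀ ℕ)} {ε : F.ι 0 → k} (hF : F.Resolves (edgeFree G) ε) (i d : ℤ) :
    betti k G i d = F.total i d := by
  classical
  rcases i with i | i
  · rcases d with d | d
    · refine finsum_congr fun a => ?_
      refine finsum_congr_Prop (propext Nat.cast_inj.symm) fun _ => ?_
      exact ((resolution k G).betti_toPosetComplex i a).symm.trans
        ((resolution k G).resolves.betti_eq hF i a)
    · refine (finsum_mem_eq_zero_of_forall_eq_zero fun a ha => ?_).symm
      have : (a.degree : ℤ) = Int.negSucc d := ha
      omega
  · have h : F.total (Int.negSucc i) d = 0 :=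
      finsum_mem_eq_zero_of_forall_eq_zero fun a _ => rfl
    rw [h]
    rcases d with d | d <;> rfl

theorem exists_resolves (k : Type*) [Field k] {V : Type*} [Finite V] (G : SimpleGraph V) :
    ∃ (F : PosetComplex k (V →₀ ℕ)) (ε : F.ι 0 → k), F.Resolves (edgeFree G) ε :=
  ⟨_, _, (resolution k G).resolves⟩

/-- The cone argument for the exact sequence 0 → vx·M' → M' → R/I(T) → 0. Here S and S' are the
degrees of M' and of its submodule vx·M', the latter resolved by killing W over T'' and translating
by the degree δ of vx. -/
theorem betti_eq_of_leaf (k : Type*) [Field k] {V : Type*} [Finite V] (T : SimpleGraph V)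
    (v x : V) (W : Finset V) (hx : x ∉ W) (hv : ∀ y, T.Adj v y ↔ y = x ∨ y ∈ W)
    (hleaf : ∀ y, T.Adj x y → y = v) (i d : ℤ) :
    betti k T i d = betti k (T.induce {x}ᶜ) i d +
      ∑ j ∈ Finset.range (W.card + 1), W.card.choose j *
        betti k (T.induce (insert v (insert x (W : Set V)))ᶜ)
          (i - ((j : ℤ) + 1)) (d - ((j : ℤ) + 2)) := by
  classical
  set s₁ : Set V := {x}ᶜ with hs₁
  set s₂ : Set V := (insert v (insert x (W : Set V)))ᶜ with hs₂
  have hvx : T.Adj v x := (hv x).2 (Or.inl rfl)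
  obtain ⟨F', ε', hF'⟩ := exists_resolves k (T.induce s₁)
  obtain ⟨F'', ε'', hF''⟩ := exists_resolves k (T.induce s₂)
  have hW₂ : ∀ w ∈ W, w ∉ s₂ := fun w hw h => h (by simp [hw])
  obtain ⟨C, ε, hC, -, hCtot⟩ := hF''.extend.exists_quotient W
    (fun w hw i p => F''.extend_deg_apply p (hW₂ w hw)) (by
      intro w hw a
      have : (a + Finsupp.single w 1).subtypeDomain (· ∈ s₂) = a.subtypeDomain (· ∈ s₂) := by
        ext y
        have hy : (y : V) ≠ w := fun h => hW₂ w hw (h ▸ y.2)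
        simp [Finsupp.single_eq_of_ne hy]
      rw [Set.mem_ofPred_eq, Set.mem_ofPred_eq, this])
  set δ : V →₀ ℕ := Finsupp.single v 1 + Finsupp.single x 1 with hδ
  have hδ_le : ∀ a, δ ≤ a ↔ a v ≠ 0 ∧ a x ≠ 0 := single_add_single_le_iff hvx.ne
  have hE₁ : ∀ a : V →₀ ℕ, a.subtypeDomain (· ∈ s₁) ∈ edgeFree (T.induce s₁) ↔
      ∀ y z, y ≠ x → z ≠ x → T.Adj y z → a y = 0 ∨ a z = 0 := fun a =>
    ⟨fun h y z hy hz hyz => h ⟨y, hy⟩ ⟨z, hz⟩ hyz, fun h y z hyz => h y z y.2 z.2 hyz⟩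
  have hE₂ : ∀ a : V →₀ ℕ, a.subtypeDomain (· ∈ s₂) ∈ edgeFree (T.induce s₂) ↔
      ∀ y z, y ∈ s₂ → z ∈ s₂ → T.Adj y z → a y = 0 ∨ a z = 0 := fun a =>
    ⟨fun h y z hy hz hyz => h ⟨y, hy⟩ ⟨z, hz⟩ hyz, fun h y z hyz => h y z y.2 z.2 hyz⟩
  have hδ₂ : ∀ y, y ≠ v → y ≠ x → δ y = 0 := fun y hyv hyx => by
    rw [hδ, Finsupp.add_apply, Finsupp.single_eq_of_ne hyv, Finsupp.single_eq_of_ne hyx,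
      add_zero]
  have hs₂_iff : ∀ y, y ∈ s₂ ↔ y ≠ v ∧ y ≠ x ∧ y ∉ W := fun y => by simp [hs₂]
  have hD := hC.translate δ
  have hG := hF'.extend
  set S : Set (V →₀ ℕ) := {a | a.subtypeDomain (· ∈ s₁) ∈ edgeFree (T.induce s₁)} with hSdef
  set S' : Set (V →₀ ℕ) := {a | δ ≤ a ∧ a - δ ∈ {a | a ∈ {a : V →₀ ℕ |
    a.subtypeDomain (· ∈ s₂) ∈ edgeFree (T.induce s₂)} ∧ ∀ w ∈ W, a w = 0}} with hS'def
  have hS : ∀ a, a ∈ S ↔ ∀ y z, y ≠ x → z ≠ x → T.Adj y z → a y = 0 ∨ a z = 0 := hE₁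
  have hS' : ∀ a, a ∈ S' ↔ (a v ≠ 0 ∧ a x ≠ 0) ∧
      (∀ y z, y ∈ s₂ → z ∈ s₂ → T.Adj y z → a y = 0 ∨ a z = 0) ∧ ∀ w ∈ W, a w = 0 := by
    intro a
    refine and_congr (hδ_le a) (and_congr ((hE₂ _).trans ?_) (forall₂_congr fun w hw => ?_))
    · refine forall₄_congr fun y z hy hz => ?_
      rw [Finsupp.tsub_apply, Finsupp.tsub_apply, hδ₂ y ((hs₂_iff y).1 hy).1
        ((hs₂_iff y).1 hy).2.1, hδ₂ z ((hs₂_iff z).1 hz).1 ((hs₂_iff z).1 hz).2.1, tsub_zero,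
        tsub_zero]
    · rw [Finsupp.tsub_apply, hδ₂ w ((hv w).2 (Or.inr hw)).ne' (ne_of_mem_of_not_mem hw hx),
        tsub_zero]
  -- An edge of T' meeting W has an end with exponent 0; an edge at v has its other end in W; every
  -- remaining edge lies in T''.
  have hsub : S' ⊆ S := by
    intro a ha
    obtain ⟨-, h1, h2⟩ := (hS' a).1 ha
    rw [hS]
    intro y z hy hz hyz
    by_cases hyW : y ∈ W
    · exact Or.inl (h2 y hyW)
    by_cases hzW : z ∈ W
    · exact Or.inr (h2 z hzW)
    by_cases hyv : y = v
    · exact absurd ((hv z).1 (hyv ▸ hyz)) (not_or_intro hz hzW)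
    by_cases hzv : z = v
    · exact absurd ((hv y).1 (hzv ▸ hyz.symm)) (not_or_intro hy hyW)
    exact h1 y z ((hs₂_iff y).2 ⟨hyv, hy, hyW⟩) ((hs₂_iff z).2 ⟨hzv, hz, hzW⟩) hyz
  -- The edges vw force the exponents on W to vanish as soon as v occurs: this is where the colon
  -- ideal acquires the variables of W.
  have hmem : ∀ b ∈ S, b v ≠ 0 → b x ≠ 0 → b ∈ S' := by
    intro b hb hbv hbx
    rw [hS] at hb
    refine (hS' b).2 ⟨⟨hbv, hbx⟩, fun y z hy hz => ?_, fun w hw => ?_⟩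
    · exact hb y z ((hs₂_iff y).1 hy).2.1 ((hs₂_iff z).1 hz).2.1
    · exact (hb v w hvx.ne (ne_of_mem_of_not_mem hw hx) ((hv w).2 (Or.inr hw))).resolve_left hbv
  have hup : ∀ a ∈ S', ∀ b ∈ S, a ≤ b → b ∈ S' := by
    intro a ha b hb hab
    obtain ⟨⟨h1, h2⟩, -⟩ := (hS' a).1 ha
    exact hmem b hb (fun h => h1 (Nat.le_zero.1 ((hab v).trans h.le)))
      fun h => h2 (Nat.le_zero.1 ((hab x).trans h.le))
  -- As x is a leaf at v, the only edge of T missing from T' is vx, so a monomial outside I(T')R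
  -- lies in I(T) exactly when both v and x occur in it.
  have hT : edgeFree T = S \ S' := by
    ext a
    constructor
    · intro ha
      refine ⟨(hS a).2 fun y z _ _ h => ha y z h, fun h => ?_⟩
      have := ((hS' a).1 h).1
      exact (ha v x hvx).elim this.1 this.2
    · rintro ⟨h1, h2⟩ y z hyz
      have hvx' : a v = 0 ∨ a x = 0 := by
        by_contra h
        rw [not_or] at h
        exact h2 (hmem a h1 h.1 h.2)
      by_cases hy : y = x
      · subst hy
        rw [hleaf z hyz]
        exact hvx'.symm
      by_cases hz : z = x
      · subst hz
        rw [hleaf y hyz.symm]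
        exact hvx'
      exact (hS a).1 h1 y z hy hz hyz
  obtain ⟨φ, hφ⟩ := hD.exists_hom hG hsub hup
  have hcone := hD.cone hG hsub hup φ hφ
  rw [← hT] at hcone
  have hne : ∀ i p q, F'.extend.deg i p ≠ (C.translate δ).deg i q := by
    intro i p (q : C.ι i) h
    have h1 : F'.extend.deg i p x = C.deg i q x + δ x := DFunLike.congr_fun h x
    have h2 := ((hδ_le δ).1 le_rfl).2
    -- The vertex x is absent from T', so its exponent is 0 on one side and at least δ x ≥ 1 on the
    -- other.
    rw [F'.extend_deg_apply p (fun h => h rfl)] at h1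
    omega
  rw [betti_eq_total T hcone, total_cone φ hne, add_comm, total_extend,
    betti_eq_total (T.induce s₁) hF', total_translate, hCtot]
  congr 1
  refine Finset.sum_congr rfl fun j _ => ?_
  rw [total_extend, betti_eq_total (T.induce s₂) hF'', hδ, map_add, Finsupp.degree_single,
    Finsupp.degree_single]
  push_cast
  congr 2 <;> ring

end GraphBetti

theorem mainTheorem1 (k : Type*) [Field k] {V : Type*} [Fintype V]
    (T : SimpleGraph V) [DecidableRel T.Adj] (hT : T.IsAcyclic)
    (v : V) (n : ℕ) (hn : 0 < n) (u : Fin n → V) (hu : Function.Injective u)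
    (hnb : ∀ x, T.Adj v x ↔ x ∈ Set.range u)
    (hleaf : ∀ j : Fin n, (j : ℕ) + 1 < n → T.degree (u j) = 1)
    (hfirst : T.degree (u ⟨0, hn⟩) = 1) (i d : ℤ) :
    GraphBetti.betti k T i d =
      GraphBetti.betti k (T.induce {u ⟨0, hn⟩}ᶜ) i d +
        ∑ j ∈ Finset.range n, (n - 1).choose j *
          GraphBetti.betti k (T.induce (insert v (Set.range u))ᶜ)
            (i - ((j : ℤ) + 1)) (d - ((j : ℤ) + 2)) := by
  classical
  -- The neighbours of v other than the chosen leaf; there are n − 1 of them, which gives the upper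
  -- entry of the binomial coefficients.
  let W : Finset V := (Finset.univ.erase ⟨0, hn⟩).image u
  have hcard : W.card = n - 1 := by
    rw [Finset.card_image_of_injective _ hu, Finset.card_erase_of_mem (Finset.mem_univ _),
      Finset.card_univ, Fintype.card_fin]
  have hrange : Set.range u = insert (u ⟨0, hn⟩) (W : Set V) := by
    rw [Finset.coe_image, Finset.coe_erase, Finset.coe_univ, ← Set.image_insert_eq,
      Set.insert_sdiff_singleton, Set.insert_eq_of_mem (Set.mem_univ _), Set.image_univ]
  have hx : u ⟨0, hn⟩ ∉ W := by
    simp only [W, Finset.mem_image, Finset.mem_erase, hu.eq_iff]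
    rintro ⟨j, ⟨h, -⟩, rfl⟩
    exact h rfl
  have hv : ∀ y, T.Adj v y ↔ y = u ⟨0, hn⟩ ∨ y ∈ W := fun y => by
    rw [hnb, hrange]
    rfl
  have h1 : ∀ y, T.Adj (u ⟨0, hn⟩) y → y = v := by
    intro y hy
    obtain ⟨z, hz⟩ := T.degree_eq_one_iff_existsUnique_adj.1 hfirst
    rw [hz.2 y hy, hz.2 v ((hv _).2 (Or.inl rfl)).symm]
  rw [GraphBetti.betti_eq_of_leaf k T v (u ⟨0, hn⟩) W hx hv h1, hcard, Nat.sub_add_cancel hn,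
    hrange]
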